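/- Fix an integer $s\ge 1$. For $n,k\ge 0$ let $D_{n,k}$ be the $s$-associated Stirling number of the second kind, that is, the number of set partitions of an $n$-element set into $k$ blocks, each of size at least $s$ (so $D_{0,0}=1$), and let $D_n(x)=\sum_{k=0}^{n}D_{n,k}x^k$. For $n\ge s$ let $X_n$ be the number of blocks of a uniformly random set partition of an $n$-element set into blocks of size at least $s$, i.e. $\mathbf P(X_n=k)=D_{n,k}/D_n(1)$. Then $X_n$ is asymptotically normal, with mean asymptotic to $n/\log n$ and variance asymptotic to $n/\log^2 n$: as $n\to\infty$, $$\frac{X_n-\mathbf E X_n}{\sqrt{\operatorname{Var}X_n}}\longrightarrow N(0,1)\ \text{ in distribution},\qquad \mathbf E X_n\sim\frac{n}{\log n},\qquad \operatorname{Var}X_n\sim\frac{n}{\log^2 n}.$$ Moreover, for all complex $x$ and $z$, $$\sum_{n\ge 0}\frac{z^n}{n!}D_n(x)=\exp\Big\{x\Big(e^z-\sum_{j=0}^{s-1}\frac{z^j}{j!}\Big)\Big\}.$$ -/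

import Mathlib

open MeasureTheory ProbabilityTheory Filter Topology Asymptotics

/-- Set partitions of the `n`-element set `Fin n` all of whose blocks have at least `s` elements. -/
abbrev BigBlockPartition (s n : ℕ) : Type :=
  {P : Finpartition (Finset.univ : Finset (Fin n)) // ∀ B ∈ P.parts, s ≤ B.card}

/-- Every set of partitions is an event. -/
instance BigBlockPartition.instMeasurableSpace (s n : ℕ) :
    MeasurableSpace (BigBlockPartition s n) := ⊤

/-- The number of blocks of a partition. -/
def numBlocks {s n : ℕ} (P : BigBlockPartition s n) : ℕ := P.1.parts.card

/-- The `s`-associated Stirling number of the second kind: the number of partitions of an `n`-set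
into `k` blocks, each of size at least `s`. -/
def assocStirling (s n k : ℕ) : ℕ := Fintype.card {P : BigBlockPartition s n // numBlocks P = k}

/-- The uniform distribution on the partitions of an `n`-set into blocks of size at least `s`
(a probability measure as soon as there is such a partition, in particular for `n ≥ s`). -/
noncomputable def uniformPartition (s n : ℕ) : Measure (BigBlockPartition s n) :=
  uniformOn Set.univ

/-- The mean of the number of blocks of a uniformly random partition of an `n`-set into blocks of
size at least `s`. -/
noncomputable def meanBlocks (s n : ℕ) : ℝ :=
  ∫ P, (numBlocks P : ℝ) ∂(uniformPartition s n)

/-- The variance of the number of blocks of a uniformly random partition of an `n`-set into blocks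
of size at least `s`. -/
noncomputable def varBlocks (s n : ℕ) : ℝ :=
  variance (fun P => (numBlocks P : ℝ)) (uniformPartition s n)

/-- If `s ≤ n`, there is a partition of an `n`-set into blocks of size at least `s`. -/
theorem BigBlockPartition.nonempty {s n : ℕ} (h : s ≤ n) : Nonempty (BigBlockPartition s n) := by
  rcases Nat.eq_zero_or_pos n with rfl | hn
  · obtain rfl : s = 0 := by omega
    exact ⟨⟨Finpartition.ofErase {Finset.univ} (by simp) (by simp), by simp⟩⟩
  · have : Nonempty (Fin n) := ⟨⟨0, hn⟩⟩
    refine ⟨⟨Finpartition.indiscrete Finset.univ_nonempty.ne_empty, ?_⟩⟩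
    intro B hB
    rw [Finpartition.indiscrete_parts, Finset.mem_singleton] at hB
    subst hB
    simpa using h

instance uniformPartition.instIsProbabilityMeasure (s : ℕ) (n : {n : ℕ // s ≤ n}) :
    IsProbabilityMeasure (uniformPartition s n) := by
  have := BigBlockPartition.nonempty n.2
  exact isProbabilityMeasure_uniformOn Set.finite_univ Set.univ_nonempty

/-! The proof is a saddle point analysis of the moment generating function of the number of blocks.

Removing the block that contains a given point yields a recurrence for `blockSum`. The function `exp
(x * (exp z - expTaylor s z))` is entire, and Leibniz's rule applied to its logarithmic derivative
gives its Taylor coefficients the same recurrence; this is `hasSum_sum_pow_numBlocks`. With `x = exp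
τ`, Cauchy's formula expresses the sum of `exp (τ * numBlocks P)` as an integral over a circle. Take
`r * exp r = n` and points `z = r * exp (iθ - τ / r)`. The complex radius makes the factor `z ^
(-n)` produce exactly `exp (τ * exp r)`, so it centres the number of blocks at `exp r`, and it
cancels the linear dependence of the exponent on `τ` at the saddle
(`exists_sum_exp_eq_mul_saddleIntegral`).

Put `τ = t / blockScale r` and `θ = y * saddleWidth r`. The exponent tends to `t² / 2 - y² / 2`
(`tendsto_saddleExponent`), and an exponential bound uniform over the whole circle
(`exists_bound_exp_saddleExponent`) permits dominated convergence. Dividing by the case `τ = 0`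
removes all prefactors, so the moment generating function of `scaledBlocks` tends to `exp (t² / 2)`
locally uniformly in complex `t` (`tendstoLocallyUniformlyOn_blockMgf`).

Derivatives at `0` then give the limits `0` and `1` of the first two moments; imaginary arguments
give the characteristic function, hence the normal limit. The asymptotics of the mean and variance
follow from `exp r = n / r`, `blockScale r ^ 2 = n / r²` and `log n = r + log r`. -/

/-! ### Recurrence for the block-counting polynomial. -/

/-- The generating polynomial, evaluated at `x`, of the number of blocks over all partitions of `S`
into blocks of size at least `s`. -/
noncomputable def blockSum {α : Type*} [DecidableEq α] (s : ℕ) (x : ℂ) (S : Finset α) : ℂ :=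
  ∑ P : Finpartition S with ∀ B ∈ P.parts, s ≤ B.card, x ^ P.parts.card

theorem blockSum_empty {α : Type*} [DecidableEq α] (s : ℕ) (x : ℂ) :
    blockSum s x (∅ : Finset α) = 1 := by
  have h : ∀ P : Finpartition (∅ : Finset α), P.parts = ∅ := fun P => by
    rw [Finpartition.parts_eq_empty_iff]; rfl
  have hu : (Finset.univ : Finset (Finpartition (∅ : Finset α))) =
      {Finpartition.empty (Finset α)} := by
    ext P
    simp only [Finset.mem_univ, Finset.mem_singleton, true_iff]
    exact Finpartition.ext ((h P).trans (h _).symm)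
  rw [blockSum, Finset.filter_true_of_mem]
  · erw [hu, Finset.sum_singleton]
    simp [Finpartition.empty]
  · intro P _ B hB
    simp [h P] at hB

/-- Adding to a partition of `U ⊆ S` the block that consists of `a` and of `S \ U`. -/
def Finpartition.addBlock {α : Type*} [DecidableEq α] {S U : Finset α} {a : α} (ha : a ∉ S)
    (hU : U ⊆ S) (Q : Finpartition U) : Finpartition (insert a S) :=
  Q.extend (b := insert a (S \ U)) (Finset.insert_ne_empty _ _)
    (by
      rw [Finset.disjoint_insert_right]
      exact ⟨fun h => ha (hU h), Finset.disjoint_sdiff⟩)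
    (by
      rw [Finset.sup_eq_union, Finset.union_insert, Finset.union_sdiff_of_subset hU])

theorem Finpartition.addBlock_parts {α : Type*} [DecidableEq α] {S U : Finset α} {a : α}
    (ha : a ∉ S) (hU : U ⊆ S) (Q : Finpartition U) :
    (Q.addBlock ha hU).parts = insert (insert a (S \ U)) Q.parts := rfl

theorem Finpartition.newBlock_notMem {α : Type*} [DecidableEq α] {S U : Finset α} {a : α}
    (ha : a ∉ S) (hU : U ⊆ S) (Q : Finpartition U) : insert a (S \ U) ∉ Q.parts := fun h =>
  ha (hU (Q.subset h (Finset.mem_insert_self _ _)))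

/-- Sort the partitions by the union `U` of the blocks that miss `a`: the block of `a` is then
forced, and the rest is an arbitrary admissible partition of `U`. -/
theorem blockSum_insert {α : Type*} [DecidableEq α] (s : ℕ) (x : ℂ) {S : Finset α} {a : α}
    (ha : a ∉ S) :
    blockSum s x (insert a S) =
      ∑ U ∈ S.powerset with s ≤ (S \ U).card + 1, x * blockSum s x U := by
  simp only [blockSum, Finset.mul_sum]
  rw [Finset.sum_sigma']
  symm
  have hcard : ∀ U : Finset α, (insert a (S \ U)).card = (S \ U).card + 1 := fun U =>
    Finset.card_insert_of_notMem fun h => ha (Finset.sdiff_subset h)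
  refine Finset.sum_bij (fun p hp => Finpartition.addBlock ha (U := p.1)
    (by simp only [Finset.mem_sigma, Finset.mem_filter, Finset.mem_powerset] at hp
        exact hp.1.1) p.2) ?_ ?_ ?_ ?_
  · rintro ⟨U, Q⟩ hp
    simp only [Finset.mem_sigma, Finset.mem_filter, Finset.mem_powerset, Finset.mem_univ,
      true_and] at hp ⊢
    rw [Finpartition.addBlock_parts]
    intro B hB
    rcases Finset.mem_insert.1 hB with rfl | hB
    · rw [hcard]; exact hp.1.2
    · exact hp.2 B hB
  · rintro ⟨U, Q⟩ hp ⟨U', Q'⟩ hp' h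
    simp only [Finset.mem_sigma, Finset.mem_filter, Finset.mem_powerset, Finset.mem_univ,
      true_and] at hp hp'
    have hparts := congrArg Finpartition.parts h
    rw [Finpartition.addBlock_parts, Finpartition.addBlock_parts] at hparts
    -- Since `a ∉ S`, the added block is the only one containing `a`, so it can be recovered from
    -- the partition.
    have hU : insert a (S \ U) = insert a (S \ U') := by
      have : insert a (S \ U) ∈ insert (insert a (S \ U')) Q'.parts := by
        rw [← hparts]; exact Finset.mem_insert_self _ _
      rcases Finset.mem_insert.1 this with h1 | h1
      · exact h1
      · exact absurd (hp'.1.1 (Q'.subset h1 (Finset.mem_insert_self _ _))) ha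
    have hUU : U = U' := by
      have h1 : S \ U = S \ U' := by
        have := congrArg (fun B => Finset.erase B a) hU
        simpa [Finset.erase_insert, ha] using this
      rw [← Finset.sdiff_sdiff_eq_self hp.1.1, h1, Finset.sdiff_sdiff_eq_self hp'.1.1]
    subst hUU
    have : Q.parts = Q'.parts := by
      have := congrArg (fun B => Finset.erase B (insert a (S \ U))) hparts
      simpa only [Finset.erase_insert (Finpartition.newBlock_notMem ha hp.1.1 _)] using this
    rw [Finpartition.ext this]
  · intro P hP
    simp only [Finset.mem_filter, Finset.mem_univ, true_and] at hP
    set A := P.part a with hA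
    have haS : a ∈ insert a S := Finset.mem_insert_self _ _
    have hAP : A ∈ P.parts := P.part_mem.2 haS
    have haA : a ∈ A := P.mem_part_self.2 haS
    have hAS : A ⊆ insert a S := P.subset hAP
    have hsup : (P.parts.erase A).sup id = S \ A := by
      ext b
      simp only [Finset.mem_sup, Finset.mem_erase, id, Finset.mem_sdiff]
      constructor
      · rintro ⟨B, ⟨hBA, hB⟩, hb⟩
        have hbA : b ∉ A := fun h => hBA (P.eq_of_mem_parts hB hAP hb h)
        refine ⟨?_, hbA⟩
        rcases Finset.mem_insert.1 (P.subset hB hb) with rfl | h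
        · exact absurd haA hbA
        · exact h
      · rintro ⟨hb, hbA⟩
        obtain ⟨B, hB, hbB⟩ := P.exists_mem (Finset.mem_insert_of_mem hb : b ∈ insert a S)
        exact ⟨B, ⟨fun h => hbA (h ▸ hbB), hB⟩, hbB⟩
    have hins : insert a (S \ (S \ A)) = A := by
      ext b
      simp only [Finset.mem_insert, Finset.mem_sdiff, not_and, not_not]
      constructor
      · rintro (rfl | ⟨h1, h2⟩)
        · exact haA
        · exact h2 h1
      · intro h
        rcases Finset.mem_insert.1 (hAS h) with rfl | h'
        · exact Or.inl rfl
        · exact Or.inr ⟨h', fun _ => h⟩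
    refine ⟨⟨S \ A, P.ofSubset (Finset.erase_subset A _) hsup⟩, ?_, ?_⟩
    · simp only [Finset.mem_sigma, Finset.mem_filter, Finset.mem_powerset, Finset.mem_univ,
        true_and]
      refine ⟨⟨Finset.sdiff_subset, ?_⟩, fun B hB => hP B (Finset.mem_of_mem_erase hB)⟩
      rw [← hcard, hins]
      exact hP A hAP
    · apply Finpartition.ext
      rw [Finpartition.addBlock_parts, hins]
      exact Finset.insert_erase hAP
  · rintro ⟨U, Q⟩ hp
    simp only [Finset.mem_sigma, Finset.mem_filter, Finset.mem_powerset] at hp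
    rw [Finpartition.addBlock_parts,
      Finset.card_insert_of_notMem (Finpartition.newBlock_notMem ha hp.1.1 _), pow_succ']

/-- A sequence with the recurrence of the associated Bell polynomials gives the block sums. -/
theorem blockSum_eq_of_recurrence {α : Type*} [DecidableEq α] {s : ℕ} {x : ℂ} {d : ℕ → ℂ}
    (h0 : d 0 = 1)
    (hd : ∀ n, d (n + 1) = ∑ j ∈ Finset.range (n + 1),
      (n.choose j : ℂ) * (if s ≤ n - j + 1 then x else 0) * d j) (S : Finset α) :
    blockSum s x S = d S.card := by
  induction h : S.card using Nat.strong_induction_on generalizing S with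
  | _ n ih =>
    rcases S.eq_empty_or_nonempty with rfl | ⟨a, ha⟩
    · rw [blockSum_empty, ← h, Finset.card_empty, h0]
    · obtain ⟨m, rfl⟩ : ∃ m, n = m + 1 :=
        ⟨n - 1, by have := Finset.card_pos.2 ⟨a, ha⟩; omega⟩
      have hS : (S.erase a).card = m := by rw [Finset.card_erase_of_mem ha, h]; rfl
      rw [← Finset.insert_erase ha, blockSum_insert s x (Finset.notMem_erase a S), hd,
        Finset.sum_filter]
      have : ∀ U ∈ (S.erase a).powerset,
          (if s ≤ ((S.erase a) \ U).card + 1 then x * blockSum s x U else 0) =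
            (if s ≤ m - U.card + 1 then x else 0) * d U.card := by
        intro U hU
        have hU' := Finset.mem_powerset.1 hU
        have hle := Finset.card_le_card hU'
        rw [Finset.card_sdiff_of_subset hU', hS, ih U.card (by omega) U rfl, ite_mul, zero_mul]
      rw [Finset.sum_congr rfl this, Finset.sum_powerset_apply_card
        (fun j => (if s ≤ m - j + 1 then x else 0) * d j), hS]
      refine Finset.sum_congr rfl fun j _ => ?_
      rw [nsmul_eq_mul, mul_assoc]

theorem sum_assocStirling_mul_pow (s n : ℕ) (x : ℂ) :
    ∑ k ∈ Finset.range (n + 1), (assocStirling s n k : ℂ) * x ^ k =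
      ∑ P : BigBlockPartition s n, x ^ numBlocks P := by
  have hmaps : ∀ P ∈ (Finset.univ : Finset (BigBlockPartition s n)),
      numBlocks P ∈ Finset.range (n + 1) := by
    intro P _
    have := P.1.card_parts_le_card
    simp only [Finset.card_univ, Fintype.card_fin] at this
    exact Finset.mem_range.2 (Nat.lt_succ_of_le this)
  rw [← Finset.sum_fiberwise_of_maps_to hmaps]
  refine Finset.sum_congr rfl fun k _ => ?_
  rw [Finset.sum_congr rfl (g := fun _ => x ^ k)
    (fun P hP => by rw [(Finset.mem_filter.1 hP).2]), Finset.sum_const, nsmul_eq_mul,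
    assocStirling, Fintype.card_subtype]

theorem sum_pow_numBlocks (s n : ℕ) (x : ℂ) :
    ∑ P : BigBlockPartition s n, x ^ numBlocks P =
      blockSum s x (Finset.univ : Finset (Fin n)) := by
  rw [blockSum]
  exact (Finset.sum_subtype (p := fun P : Finpartition (Finset.univ : Finset (Fin n)) =>
    ∀ B ∈ P.parts, s ≤ B.card) _ (by simp) (fun P => x ^ P.parts.card)).symm

/-! ### The exponential generating function. -/

/-- The Taylor polynomial of the exponential function with `s` terms. -/
noncomputable def expTaylor (s : ℕ) (z : ℂ) : ℂ := ∑ j ∈ Finset.range s, z ^ j / (j.factorial : ℂ)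

theorem differentiable_expTaylor (s : ℕ) : Differentiable ℂ (expTaylor s) := by
  unfold expTaylor; fun_prop

theorem hasDerivAt_expTaylor (m : ℕ) (z : ℂ) :
    HasDerivAt (expTaylor (m + 1)) (expTaylor m z) z := by
  induction m with
  | zero =>
    have : expTaylor 1 = fun _ => (1 : ℂ) := by ext; simp [expTaylor]
    rw [zero_add, this]
    simpa [expTaylor] using hasDerivAt_const z (1 : ℂ)
  | succ m ih =>
    have h1 : expTaylor (m + 1 + 1) =
        fun z => expTaylor (m + 1) z + z ^ (m + 1) / ((m + 1).factorial : ℂ) := by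
      ext z; rw [expTaylor, Finset.sum_range_succ, ← expTaylor]
    have h2 : expTaylor (m + 1) z = expTaylor m z + z ^ m / (m.factorial : ℂ) := by
      rw [expTaylor, Finset.sum_range_succ, ← expTaylor]
    rw [h1, h2]
    refine ih.add ?_
    convert! (hasDerivAt_pow (m + 1) z).div_const ((m + 1).factorial : ℂ) using 1
    have : ((m : ℂ) + 1) ≠ 0 := by exact_mod_cast m.succ_ne_zero
    have h3 : (m.factorial : ℂ) ≠ 0 := by exact_mod_cast m.factorial_ne_zero
    rw [Nat.factorial_succ]
    push_cast
    field_simp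

theorem iteratedDeriv_exp_sub_expTaylor_zero (m k : ℕ) (x : ℂ) :
    iteratedDeriv k (fun z => x * (Complex.exp z - expTaylor m z)) 0 = if m ≤ k then x else 0 := by
  have hT : iteratedDeriv k (expTaylor m) 0 = if m ≤ k then 0 else 1 := by
    unfold expTaylor
    rw [iteratedDeriv_fun_sum (fun i _ => by fun_prop)]
    simp_rw [iteratedDeriv_div_const, iteratedDeriv_fun_pow_zero]
    have : ∀ i : ℕ, (((if k = i then i.factorial else 0 : ℕ) : ℂ)) / (i.factorial : ℂ) =
        if k = i then 1 else 0 := by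
      intro i
      split_ifs
      · exact div_self (by exact_mod_cast i.factorial_ne_zero)
      · simp
    simp_rw [this]
    simp only [Finset.sum_ite_eq, Finset.mem_range]
    split_ifs <;> first | rfl | omega
  rw [iteratedDeriv_const_mul_field]
  have h := iteratedDeriv_sub (n := k) (x := (0 : ℂ)) (f := Complex.exp) (g := expTaylor m)
    (by fun_prop) (differentiable_expTaylor m).contDiff.contDiffAt
  have h' : (fun z => Complex.exp z - expTaylor m z) = Complex.exp - expTaylor m := rfl
  rw [h', h, hT, iteratedDeriv_eq_iterate, Complex.iter_deriv_exp, Complex.exp_zero]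
  split_ifs <;> simp

/-- The bivariate exponential generating function of the associated Stirling numbers. -/
theorem hasSum_sum_pow_numBlocks {s : ℕ} (hs : 1 ≤ s) (x z : ℂ) :
    HasSum (fun n : ℕ => (∑ P : BigBlockPartition s n, x ^ numBlocks P) / (n.factorial : ℂ) * z ^ n)
      (Complex.exp (x * (Complex.exp z - expTaylor s z))) := by
  obtain ⟨m, rfl⟩ : ∃ m, s = m + 1 := ⟨s - 1, by omega⟩
  set f : ℂ → ℂ := fun z => Complex.exp (x * (Complex.exp z - expTaylor (m + 1) z)) with hf
  have hdiff : Differentiable ℂ f := by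
    have := differentiable_expTaylor (m + 1)
    fun_prop
  have hderiv : deriv f = fun z => f z * (x * (Complex.exp z - expTaylor m z)) := by
    ext z
    exact ((((Complex.hasDerivAt_exp z).sub (hasDerivAt_expTaylor m z)).const_mul x).cexp).deriv
  -- This is where `1 ≤ s` matters: the constant term of the Taylor polynomial cancels `exp 0`.
  have h0 : iteratedDeriv 0 f 0 = 1 := by
    simp [hf, expTaylor, Finset.sum_range_succ']
  -- Leibniz's rule for `f' = f * g`, where `g` has the Taylor polynomial with one term fewer; this
  -- shift is the `+ 1` that counts the distinguished point in its block.
  have hrec : ∀ n, iteratedDeriv (n + 1) f 0 = ∑ j ∈ Finset.range (n + 1),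
      (n.choose j : ℂ) * (if m + 1 ≤ n - j + 1 then x else 0) * iteratedDeriv j f 0 := by
    intro n
    have := differentiable_expTaylor m
    rw [iteratedDeriv_succ', hderiv, iteratedDeriv_fun_mul hdiff.contDiff.contDiffAt
      (Differentiable.contDiff (by fun_prop)).contDiffAt]
    refine Finset.sum_congr rfl fun j _ => ?_
    rw [iteratedDeriv_exp_sub_expTaylor_zero]
    simp only [add_le_add_iff_right]
    ring
  have := Complex.hasSum_taylorSeries_of_entire hdiff 0 z
  convert! this using 2 with n
  rw [sum_pow_numBlocks, blockSum_eq_of_recurrence (d := fun n => iteratedDeriv n f 0) h0 hrec]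
  simp only [Finset.card_univ, Fintype.card_fin, sub_zero, smul_eq_mul]
  ring

/-! ### Cauchy's coefficient formula. -/

theorem integral_exp_int_mul_I (m : ℤ) :
    ∫ θ in (-Real.pi)..Real.pi, Complex.exp ((m : ℂ) * (θ * Complex.I)) =
      if m = 0 then 2 * (Real.pi : ℂ) else 0 := by
  split_ifs with h
  · subst h
    simp
    ring
  · have hc : (m : ℂ) * Complex.I ≠ 0 := mul_ne_zero (by exact_mod_cast h) Complex.I_ne_zero
    have h1 := integral_exp_mul_complex (a := -Real.pi) (b := Real.pi) hc
    have h2 : ∀ θ : ℝ, (m : ℂ) * (θ * Complex.I) = m * Complex.I * θ := fun θ => by ring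
    simp_rw [h2, h1]
    have h3 : Complex.exp (m * Complex.I * Real.pi) =
        Complex.exp (m * Complex.I * (-Real.pi : ℝ)) := by
      rw [Complex.exp_eq_exp_iff_exists_int]
      exact ⟨m, by push_cast; ring⟩
    rw [h3, sub_self, zero_div]

/-- Cauchy's formula for the coefficients of an entire function. -/
theorem integral_entire_mul_exp_neg {c : ℕ → ℂ} {f : ℂ → ℂ}
    (h : ∀ z, HasSum (fun n => c n * z ^ n) (f z)) (w : ℂ) (n : ℕ) :
    ∫ θ in (-Real.pi)..Real.pi,
      f (w * Complex.exp (θ * Complex.I)) * Complex.exp (-(n * (θ * Complex.I))) =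
        2 * Real.pi * (c n * w ^ n) := by
  have hsum : Summable fun k => ‖c k * w ^ k‖ := (h w).summable.norm
  have key := intervalIntegral.hasSum_integral_of_dominated_convergence
    (a := -Real.pi) (b := Real.pi) (μ := volume)
    (F := fun k θ => c k * w ^ k * Complex.exp ((((k : ℤ) - n : ℤ) : ℂ) * (θ * Complex.I)))
    (f := fun θ : ℝ =>
      f (w * Complex.exp (θ * Complex.I)) * Complex.exp (-(n * (θ * Complex.I))))
    (fun k _ => ‖c k * w ^ k‖) (fun k => by
      refine Continuous.aestronglyMeasurable ?_
      fun_prop)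
    (fun k => Eventually.of_forall fun θ _ => by
      rw [norm_mul, Complex.norm_exp]
      simp)
    (Eventually.of_forall fun θ _ => hsum)
    (by simp)
    (Eventually.of_forall fun θ _ => by
      have := (h (w * Complex.exp (θ * Complex.I))).mul_right
        (Complex.exp (-(n * (θ * Complex.I))))
      convert! this using 2 with k
      rw [mul_pow, ← Complex.exp_nat_mul, mul_assoc, mul_assoc, mul_assoc,
        ← Complex.exp_add]
      congr 3
      push_cast
      ring)
  simp_rw [intervalIntegral.integral_const_mul, integral_exp_int_mul_I] at key
  rw [← key.tsum_eq, tsum_eq_single n]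
  · simp
    ring
  · intro k hk
    rw [if_neg (by omega), mul_zero]

/-! ### The exponent near the saddle. -/

/-- The logarithm of the integrand in the saddle point formula, with the saddle point at `r`. -/
noncomputable def saddleExponent (s : ℕ) (r : ℝ) (τ : ℂ) (θ : ℝ) : ℂ :=
  Complex.exp τ * (Complex.exp (r * Complex.exp (θ * Complex.I - τ / r)) -
    expTaylor s (r * Complex.exp (θ * Complex.I - τ / r))) -
    (Complex.exp r - expTaylor s r) - r * Complex.exp r * (θ * Complex.I)

/-- The standard deviation of the number of blocks, up to a factor that tends to `1`. -/
noncomputable def blockScale (r : ℝ) : ℝ := Real.exp (r / 2) / √r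

/-- The width of the saddle. -/
noncomputable def saddleWidth (r : ℝ) : ℝ := Real.exp (-(r / 2)) / r

/-- Only the quadratic term survives, because the cubic remainder is at most `‖p ζ‖² ‖ζ‖`. The lemma
is used at both levels of the double exponential. -/
theorem tendsto_sq_mul_exp_sub {ι : Type*} {l : Filter ι} {p ζ : ι → ℂ} {c : ℂ}
    (hp : Tendsto (fun i => p i * ζ i) l (𝓝 c)) (hζ : Tendsto ζ l (𝓝 0)) :
    Tendsto (fun i => p i ^ 2 * (Complex.exp (ζ i) - 1 - ζ i)) l (𝓝 (c ^ 2 / 2)) := by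
  have h1 : Tendsto (fun i => (p i * ζ i) ^ 2 / 2) l (𝓝 (c ^ 2 / 2)) := (hp.pow 2).div_const 2
  have h2 : Tendsto (fun i => p i ^ 2 * (Complex.exp (ζ i) - 1 - ζ i) - (p i * ζ i) ^ 2 / 2) l
      (𝓝 0) := by
    refine squeeze_zero_norm' (a := fun i => ‖p i * ζ i‖ ^ 2 * ‖ζ i‖) ?_ ?_
    · have : ∀ᶠ i in l, ‖ζ i‖ ≤ 1 := by
        have := hζ.norm
        rw [norm_zero] at this
        exact this.eventually_le_const one_pos
      filter_upwards [this] with i hi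
      have h3 := Complex.exp_bound hi (n := 3) (by norm_num)
      have h4 : p i ^ 2 * (Complex.exp (ζ i) - 1 - ζ i) - (p i * ζ i) ^ 2 / 2 =
          p i ^ 2 * (Complex.exp (ζ i) - ∑ m ∈ Finset.range 3, ζ i ^ m / (m.factorial : ℂ)) := by
        simp [Finset.sum_range_succ, Nat.factorial]
        ring
      rw [h4, norm_mul, norm_mul, norm_pow, mul_pow, mul_assoc]
      refine mul_le_mul_of_nonneg_left (h3.trans ?_) (by positivity)
      rw [← pow_succ]
      refine mul_le_of_le_one_right (by positivity) ?_
      norm_num [Nat.factorial]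
    · simpa using (hp.norm.pow 2).mul hζ.norm
  simpa using h2.add h1

theorem blockScale_pos {r : ℝ} (hr : 0 < r) : 0 < blockScale r := by
  unfold blockScale; positivity

theorem norm_expTaylor_le {m s : ℕ} (hm : m ≤ s) {R : ℝ} (hR : 1 ≤ R) {z : ℂ} (hz : ‖z‖ ≤ R) :
    ‖expTaylor m z‖ ≤ s * R ^ s := by
  refine (norm_sum_le _ _).trans ?_
  have : ∀ j ∈ Finset.range m, ‖z ^ j / (j.factorial : ℂ)‖ ≤ R ^ s := by
    intro j hj
    rw [norm_div, norm_pow, Complex.norm_natCast]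
    refine (div_le_self (by positivity) (by exact_mod_cast j.factorial_pos)).trans ?_
    refine (pow_le_pow_left₀ (norm_nonneg _) hz j).trans ?_
    exact pow_le_pow_right₀ hR ((Finset.mem_range.1 hj).le.trans hm)
  refine (Finset.sum_le_sum this).trans ?_
  rw [Finset.sum_const, Finset.card_range, nsmul_eq_mul]
  gcongr

theorem norm_expTaylor_sub_le {s : ℕ} {R : ℝ} (hR : 1 ≤ R) {z w : ℂ} (hz : ‖z‖ ≤ R)
    (hw : ‖w‖ ≤ R) : ‖expTaylor s z - expTaylor s w‖ ≤ s * R ^ s * ‖z - w‖ := by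
  rcases s with _ | m
  · simp [expTaylor]
  · refine (convex_closedBall (0 : ℂ) R).norm_image_sub_le_of_norm_hasDerivWithin_le
      (f := expTaylor (m + 1)) (f' := expTaylor m)
      (fun x _ => (hasDerivAt_expTaylor m x).hasDerivWithinAt)
      (fun x hx => norm_expTaylor_le m.le_succ hR (by simpa using hx)) (by simpa using hw)
      (by simpa using hz)

theorem norm_exp_mul_I_sub_one_le (θ : ℝ) : ‖Complex.exp (θ * Complex.I) - 1‖ ≤ |θ| := by
  rw [mul_comm]; exact Real.norm_exp_I_mul_ofReal_sub_one_le

/-- The Taylor polynomial and its derivative grow only polynomially in `r`, whereas `τ` and `θ` are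
exponentially small on the saddle scale; hence the restriction on block sizes does not affect the
limit. The factor `3` comes from `‖z‖ ≤ exp 1 * r`. -/
theorem norm_exp_mul_expTaylor_sub_le (s : ℕ) {r : ℝ} (hr : 1 ≤ r) {τ : ℂ} (hτ : ‖τ‖ ≤ 1) (θ : ℝ) :
    ‖Complex.exp τ * expTaylor s (r * Complex.exp (θ * Complex.I - τ / r)) - expTaylor s r‖ ≤
      s * (3 * r) ^ s * (4 * ‖τ‖ + r * |θ|) := by
  set z : ℂ := r * Complex.exp (θ * Complex.I - τ / r) with hz
  have hr0 : (0 : ℝ) < r := by linarith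
  have hv : ‖τ / r‖ ≤ 1 := by
    rw [norm_div, Complex.norm_of_nonneg hr0.le]
    exact (div_le_self (norm_nonneg _) hr).trans hτ
  have hznorm : ‖z‖ ≤ 3 * r := by
    rw [hz, norm_mul, Complex.norm_of_nonneg hr0.le, Complex.norm_exp, mul_comm]
    refine mul_le_mul_of_nonneg_right ?_ hr0.le
    have h1 : (θ * Complex.I - τ / r).re ≤ 1 := by
      have := (Complex.abs_re_le_norm (τ / r)).trans hv
      simp only [Complex.sub_re, Complex.mul_re, Complex.ofReal_re, Complex.I_re, mul_zero,
        Complex.ofReal_im, zero_mul, sub_zero, zero_sub]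
      linarith [neg_le_of_abs_le this]
    exact (Real.exp_le_exp.2 h1).trans Real.exp_one_lt_three.le
  have hrnorm : ‖(r : ℂ)‖ ≤ 3 * r := by
    rw [Complex.norm_of_nonneg hr0.le]; linarith
  have hR : 1 ≤ 3 * r := by linarith
  have hzr : ‖z - r‖ ≤ r * |θ| + 2 * ‖τ‖ := by
    have : z - r = r * (Complex.exp (θ * Complex.I) - 1) +
        r * (Complex.exp (θ * Complex.I) * (Complex.exp (-(τ / r)) - 1)) := by
      rw [hz, sub_eq_add_neg (θ * Complex.I : ℂ), Complex.exp_add]; ring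
    rw [this]
    refine (norm_add_le _ _).trans (add_le_add ?_ ?_)
    · rw [norm_mul, Complex.norm_of_nonneg hr0.le]
      exact mul_le_mul_of_nonneg_left (norm_exp_mul_I_sub_one_le θ) hr0.le
    · rw [norm_mul, norm_mul, Complex.norm_of_nonneg hr0.le, Complex.norm_exp_ofReal_mul_I, one_mul]
      have := Complex.norm_exp_sub_one_le (x := -(τ / r)) (by rwa [norm_neg])
      rw [norm_neg, norm_div, Complex.norm_of_nonneg hr0.le] at this
      calc r * ‖Complex.exp (-(τ / r)) - 1‖ ≤ r * (2 * (‖τ‖ / r)) := by gcongr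
        _ = 2 * ‖τ‖ := by field_simp
  have : Complex.exp τ * expTaylor s z - expTaylor s r =
      (Complex.exp τ - 1) * expTaylor s z + (expTaylor s z - expTaylor s r) := by ring
  rw [this]
  refine (norm_add_le _ _).trans ?_
  rw [norm_mul]
  have h1 := norm_expTaylor_le le_rfl hR hznorm (s := s)
  have h2 := (norm_expTaylor_sub_le hR hznorm hrnorm (s := s)).trans
    (mul_le_mul_of_nonneg_left hzr (by positivity))
  have h3 := mul_le_mul (Complex.norm_exp_sub_one_le hτ) h1 (norm_nonneg _) (by positivity)
  refine (add_le_add h3 h2).trans (le_of_eq ?_)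
  ring

theorem tendsto_pow_mul_exp_neg_half (k : ℕ) :
    Tendsto (fun r : ℝ => r ^ k * Real.exp (-(r / 2))) atTop (𝓝 0) := by
  have h := (Real.tendsto_pow_mul_exp_neg_atTop_nhds_zero k).comp
    (tendsto_id.atTop_div_const (two_pos : (0 : ℝ) < 2))
  have := h.const_mul ((2 : ℝ) ^ k)
  rw [mul_zero] at this
  refine this.congr fun r => ?_
  simp only [Function.comp, id, div_pow]
  field_simp

/-- Scaled form of the bound on the contribution of the Taylor polynomial. -/
theorem exists_bound_expTaylor (s : ℕ) : ∃ b : ℝ → ℝ, Tendsto b atTop (𝓝 0) ∧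
    ∀ (r : ℝ) (t : ℂ) (y : ℝ), 1 ≤ r → ‖t / blockScale r‖ ≤ 1 →
      ‖Complex.exp (t / blockScale r) * expTaylor s (r * Complex.exp
        ((y * saddleWidth r : ℝ) * Complex.I - t / blockScale r / r)) - expTaylor s r‖ ≤
        b r * (‖t‖ + |y|) := by
  refine ⟨fun r => (s * 3 ^ s * 4) * (r ^ (s + 1) * Real.exp (-(r / 2))), ?_, ?_⟩
  · simpa using (tendsto_pow_mul_exp_neg_half (s + 1)).const_mul (s * 3 ^ s * 4 : ℝ)
  · intro r t y hr ht
    refine (norm_exp_mul_expTaylor_sub_le s hr ht _).trans ?_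
    have hr0 : 0 < r := by linarith
    have h1 : ‖t / blockScale r‖ ≤ r * Real.exp (-(r / 2)) * ‖t‖ := by
      rw [norm_div, Complex.norm_of_nonneg (blockScale_pos hr0).le, blockScale, Real.exp_neg]
      have : √r ≤ r := by
        rw [Real.sqrt_le_left hr0.le]; nlinarith
      calc ‖t‖ / (Real.exp (r / 2) / √r) = √r * (Real.exp (r / 2))⁻¹ * ‖t‖ := by field_simp
        _ ≤ _ := by gcongr
    have h2 : r * |y * saddleWidth r| ≤ r * Real.exp (-(r / 2)) * |y| := by
      rw [saddleWidth, abs_mul, abs_of_nonneg (by positivity : 0 ≤ Real.exp (-(r / 2)) / r)]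
      calc r * (|y| * (Real.exp (-(r / 2)) / r)) = 1 * Real.exp (-(r / 2)) * |y| := by field_simp
        _ ≤ _ := by gcongr
    have hE := Real.exp_pos (-(r / 2))
    calc s * (3 * r) ^ s * (4 * ‖t / blockScale r‖ + r * |y * saddleWidth r|)
        ≤ s * (3 * r) ^ s * (4 * (r * Real.exp (-(r / 2)) * ‖t‖) +
            4 * (r * Real.exp (-(r / 2)) * |y|)) := by
          have : 0 ≤ r * Real.exp (-(r / 2)) * |y| := by positivity
          refine mul_le_mul_of_nonneg_left (add_le_add ?_ (h2.trans ?_)) (by positivity) <;> linarith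
      _ = s * 3 ^ s * 4 * (r ^ (s + 1) * Real.exp (-(r / 2))) * (‖t‖ + |y|) := by
          rw [mul_pow, pow_succ]; ring

theorem tendsto_blockScale : Tendsto blockScale atTop atTop := by
  have h := tendsto_pow_mul_exp_neg_half 1
  have h2 : Tendsto (fun r : ℝ => Real.exp (r / 2) / r) atTop atTop := by
    have h3 : Tendsto (fun r : ℝ => r ^ 1 * Real.exp (-(r / 2))) atTop (𝓝[>] 0) := by
      rw [tendsto_nhdsWithin_iff]
      refine ⟨h, ?_⟩
      filter_upwards [eventually_gt_atTop 0] with r hr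
      exact Set.mem_Ioi.2 (by positivity)
    refine h3.inv_tendsto_nhdsGT_zero.congr fun r => ?_
    rw [Pi.inv_apply, pow_one, Real.exp_neg, mul_inv, inv_inv, mul_comm, ← div_eq_mul_inv]
  refine tendsto_atTop_mono' _ ?_ h2
  filter_upwards [eventually_ge_atTop 1] with r hr
  rw [blockScale]
  have : √r ≤ r := by
    rw [Real.sqrt_le_left (by linarith)]; nlinarith
  gcongr

/-- The exponent near the saddle, on the scale of its width. -/
theorem tendsto_saddleExponent (s : ℕ) {ι : Type*} {l : Filter ι} {r : ι → ℝ} {t : ι → ℂ} {c : ℂ}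
    (hr : Tendsto r l atTop) (ht : Tendsto t l (𝓝 c)) (y : ℝ) :
    Tendsto (fun i => saddleExponent s (r i) (t i / blockScale (r i)) (y * saddleWidth (r i))) l
      (𝓝 (c ^ 2 / 2 - (y : ℂ) ^ 2 / 2)) := by
  set τ : ι → ℂ := fun i => t i / blockScale (r i) with hτ
  set θ : ι → ℂ := fun i => ((y * saddleWidth (r i) : ℝ) : ℂ) * Complex.I with hθ
  set ζ : ι → ℂ := fun i => θ i - τ i / r i with hζ
  set p : ι → ℂ := fun i => ((Real.exp (r i / 2) * √(r i) : ℝ) : ℂ) with hp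
  set q : ι → ℂ := fun i => ((Real.exp (r i / 2) : ℝ) : ℂ) with hq
  -- Here `r + w` is the exponent of the main term `exp τ * exp z`. The scales differ: `p * ζ` tends
  -- to `-c` and will give `c² / 2`, while `q * w` tends to `y * I` and will give `-y² / 2`.
  set w : ι → ℂ := fun i => τ i + r i * (Complex.exp (ζ i) - 1) with hw
  have hpos : ∀ᶠ i in l, 1 ≤ r i := hr.eventually_ge_atTop 1
  have hsqrt : Tendsto (fun i => √(r i)) l atTop := Real.tendsto_sqrt_atTop.comp hr
  have hexp : Tendsto (fun i => Real.exp (r i / 2)) l atTop :=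
    Real.tendsto_exp_atTop.comp (hr.atTop_div_const two_pos)
  have hcast : ∀ {u : ι → ℝ}, Tendsto u l atTop →
      Tendsto (fun i => ((u i : ℝ) : ℂ)⁻¹) l (𝓝 0) := by
    intro u hu
    have := (Complex.continuous_ofReal.tendsto 0).comp hu.inv_tendsto_atTop
    simpa [Function.comp_def] using this
  have hq0 : ∀ i, q i ≠ 0 := fun i => by simp [hq]
  have hpζ : Tendsto (fun i => p i * ζ i) l (𝓝 (-c)) := by
    have h1 : Tendsto (fun i => y * Complex.I * ((√(r i) : ℝ) : ℂ)⁻¹ - t i) l (𝓝 (-c)) := by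
      simpa using ((hcast hsqrt).const_mul (y * Complex.I)).sub ht
    refine h1.congr' ?_
    filter_upwards [hpos] with i hi
    have hr0 : 0 < r i := by linarith
    have hs0 : ((√(r i) : ℝ) : ℂ) ≠ 0 := by
      exact_mod_cast (Real.sqrt_pos.2 hr0).ne'
    have hs2 : (r i : ℂ) = ((√(r i) : ℝ) : ℂ) ^ 2 := by
      exact_mod_cast (Real.sq_sqrt hr0.le).symm
    have hq' := hq0 i
    simp only [hp, hζ, hθ, hτ, blockScale, saddleWidth, Real.exp_neg]
    simp only [hq] at hq'
    push_cast at hq' ⊢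
    rw [hs2]
    field_simp
  have hζ0 : Tendsto ζ l (𝓝 0) := by
    have h1 := (hcast (hexp.atTop_mul_atTop₀ hsqrt)).mul hpζ
    rw [zero_mul] at h1
    refine h1.congr' ?_
    filter_upwards [hpos] with i hi
    have : p i ≠ 0 := by
      have : 0 < r i := by linarith
      simp only [hp]
      exact_mod_cast (by positivity : Real.exp (r i / 2) * √(r i) ≠ 0)
    simp only [hp] at this ⊢
    rw [inv_mul_cancel_left₀ this]
  have h1 := tendsto_sq_mul_exp_sub hpζ hζ0
  have hp2 : ∀ᶠ i in l, p i ^ 2 * (Complex.exp (ζ i) - 1 - ζ i) =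
      q i ^ 2 * (w i - r i * θ i) := by
    filter_upwards [hpos] with i hi
    have hr0 : 0 < r i := by linarith
    have hs2 : ((√(r i) : ℝ) : ℂ) ^ 2 = (r i : ℂ) := by
      exact_mod_cast (Real.sq_sqrt hr0.le)
    have hrne : (r i : ℂ) ≠ 0 := by exact_mod_cast hr0.ne'
    -- The shift `-τ / r` in `ζ` cancels the term `τ` of `w`, so no linear contribution of `τ`
    -- remains.
    have h2 : w i - r i * θ i = r i * (Complex.exp (ζ i) - 1 - ζ i) := by
      simp only [hw, hζ]; field_simp; ring
    rw [h2]
    simp only [hp, hq]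
    push_cast
    rw [mul_pow, hs2]
    ring
  have h3 : Tendsto (fun i => q i ^ 2 * (w i - r i * θ i)) l (𝓝 (c ^ 2 / 2)) := by
    have := h1.congr' hp2
    simpa using this
  have hqθ : ∀ᶠ i in l, q i * (r i * θ i) = y * Complex.I := by
    filter_upwards [hpos] with i hi
    have hrne : (r i : ℂ) ≠ 0 := by
      have : 0 < r i := by linarith
      exact_mod_cast this.ne'
    have hq' := hq0 i
    simp only [hq, hθ, saddleWidth, Real.exp_neg] at hq' ⊢
    push_cast at hq' ⊢
    field_simp
  have hqw : Tendsto (fun i => q i * w i) l (𝓝 (y * Complex.I)) := by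
    have h4 : Tendsto (fun i => y * Complex.I + (q i)⁻¹ * (q i ^ 2 * (w i - r i * θ i))) l
        (𝓝 (y * Complex.I)) := by
      have := ((hcast hexp).mul h3).const_add (y * Complex.I)
      rwa [zero_mul, add_zero] at this
    refine h4.congr' ?_
    filter_upwards [hqθ] with i hi
    have hq' := hq0 i
    rw [← hi]
    field_simp
    ring
  have hw0 : Tendsto w l (𝓝 0) := by
    have h1 := (hcast hexp).mul hqw
    rw [zero_mul] at h1
    exact h1.congr fun i => inv_mul_cancel_left₀ (hq0 i) _
  have h5 := (tendsto_sq_mul_exp_sub hqw hw0).add h3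
  have hT : Tendsto (fun i => Complex.exp (τ i) * expTaylor s (r i * Complex.exp (ζ i)) -
      expTaylor s (r i)) l (𝓝 0) := by
    obtain ⟨b, hb, hbound⟩ := exists_bound_expTaylor s
    refine squeeze_zero_norm' (a := fun i => b (r i) * (‖t i‖ + |y|)) ?_ ?_
    · have hsm : Tendsto (fun i => ‖τ i‖) l (𝓝 0) := by
        have := (ht.mul (hcast (tendsto_blockScale.comp hr))).norm
        rw [mul_zero, norm_zero] at this
        exact this.congr fun i => by rw [← div_eq_mul_inv]; rfl
      filter_upwards [hpos, hsm.eventually_le_const one_pos] with i hi hi'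
      exact hbound (r i) (t i) y hi hi'
    · simpa using (hb.comp hr).mul (ht.norm.add_const |y|)
  have h6 := h5.sub hT
  have hlim : (y * Complex.I) ^ 2 / 2 + c ^ 2 / 2 - 0 = c ^ 2 / 2 - (y : ℂ) ^ 2 / 2 := by
    rw [mul_pow, Complex.I_sq]; ring
  rw [hlim] at h6
  refine h6.congr fun i => ?_
  have hq2 : q i ^ 2 = Complex.exp (r i) := by
    simp only [hq]
    push_cast
    rw [← Complex.exp_nat_mul]
    congr 1
    push_cast
    ring
  have hmul : Complex.exp (τ i) * Complex.exp (r i * Complex.exp (ζ i)) =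
      q i ^ 2 * Complex.exp (w i) := by
    rw [hq2, ← Complex.exp_add, ← Complex.exp_add]
    congr 1
    simp only [hw]
    ring
  have hfin : saddleExponent s (r i) (τ i) (y * saddleWidth (r i)) =
      Complex.exp (τ i) * Complex.exp (r i * Complex.exp (ζ i)) -
        (Complex.exp (τ i) * expTaylor s (r i * Complex.exp (ζ i)) - expTaylor s (r i)) -
        Complex.exp (r i) - r i * Complex.exp (r i) * θ i := by
    simp only [saddleExponent, hζ, hθ]
    ring
  rw [hfin, hmul, hq2]
  ring

/-! ### Uniform decay along the circle. -/

/-- The decay of `exp ∘ exp` along the circle of radius `r`. -/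
theorem exp_sub_exp_mul_cos_ge {r θ : ℝ} (hr : 1 ≤ r) (hr2 : r ^ 2 ≤ Real.exp (r / 2))
    (hθ : |θ| ≤ Real.pi) :
    (r * |θ| * Real.exp (r / 2) - 1) / 20 ≤
      Real.exp r - Real.exp (r * Real.cos θ) * Real.cos (r * Real.sin θ) := by
  have hr0 : 0 < r := by linarith
  have hpi : Real.pi ≤ 3.15 := Real.pi_lt_d2.le
  have hpi0 := Real.pi_pos
  have hpi2 : Real.pi ^ 2 ≤ 9.93 := by nlinarith
  set E := Real.exp (r / 2) with hE
  have hE0 : 0 < E := Real.exp_pos _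
  have hEr : Real.exp r = E ^ 2 := by rw [hE, ← Real.exp_nat_mul]; congr 1; push_cast; ring
  -- Near the saddle the decay comes from the phase, through `cos (r * sin θ)`; beyond it, from the
  -- smaller modulus `exp (r * cos θ)`.
  rcases le_total (r * |θ|) 1 with h1 | h1
  · have hθ1 : |θ| ≤ 1 := by nlinarith [abs_nonneg θ]
    have hsin : 2 / Real.pi * |θ| ≤ |Real.sin θ| := Real.mul_abs_le_abs_sin (by
      linarith [Real.pi_gt_three])
    have hu : |r * Real.sin θ| ≤ 1 := by
      rw [abs_mul, abs_of_pos hr0]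
      exact (mul_le_mul_of_nonneg_left Real.abs_sin_le_abs hr0.le).trans h1
    have hcos := Real.cos_le_one_sub_mul_cos_sq (x := r * Real.sin θ)
      (by linarith [Real.pi_gt_three])
    have hcos0 : 0 ≤ Real.cos (r * Real.sin θ) := by
      have := Real.one_sub_sq_div_two_le_cos (x := r * Real.sin θ)
      have : (r * Real.sin θ) ^ 2 ≤ 1 := by rw [← sq_abs]; nlinarith [abs_nonneg (r * Real.sin θ)]
      linarith
    have hexp : Real.exp (r * Real.cos θ) ≤ E ^ 2 := by
      rw [← hEr, Real.exp_le_exp]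
      nlinarith [Real.cos_le_one θ]
    have h20 : (1 : ℝ) / 5 ≤ 2 / Real.pi ^ 2 := by
      rw [div_le_div_iff₀ (by norm_num) (by positivity)]; linarith
    have h2pi : (1 : ℝ) / 2 ≤ 2 / Real.pi := by
      rw [div_le_div_iff₀ (by norm_num) (by positivity)]; linarith
    have hs4 : |θ| / 2 ≤ |Real.sin θ| := by
      refine le_trans ?_ hsin
      nlinarith [abs_nonneg θ]
    have hsq : (r * |θ|) ^ 2 / 20 ≤ 2 / Real.pi ^ 2 * (r * Real.sin θ) ^ 2 := by
      have h3 : (r * |θ|) ^ 2 / 4 ≤ (r * Real.sin θ) ^ 2 := by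
        rw [← sq_abs (r * Real.sin θ), abs_mul, abs_of_pos hr0]
        have h4 : 0 ≤ |θ| / 2 := by positivity
        have h5 : r * (|θ| / 2) ≤ r * |Real.sin θ| := mul_le_mul_of_nonneg_left hs4 hr0.le
        have h6 := pow_le_pow_left₀ (by positivity) h5 2
        nlinarith
      calc (r * |θ|) ^ 2 / 20 = 1 / 5 * ((r * |θ|) ^ 2 / 4) := by ring
        _ ≤ _ := mul_le_mul h20 h3 (by positivity) (by positivity)
    have h7 : Real.exp (r * Real.cos θ) * Real.cos (r * Real.sin θ) ≤
        E ^ 2 * (1 - (r * |θ|) ^ 2 / 20) :=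
      mul_le_mul hexp (by linarith) hcos0 (by positivity)
    rw [hEr]
    -- The Gaussian decay is weakened to a linear one, the form that also holds far from the saddle.
    have h8 : r * |θ| * E - 1 ≤ (r * |θ| * E) ^ 2 := by nlinarith [sq_nonneg (r * |θ| * E - 1 / 2)]
    nlinarith
  · have hcos := Real.cos_le_one_sub_mul_cos_sq hθ
    have h20 : (1 : ℝ) / 5 ≤ 2 / Real.pi ^ 2 := by
      rw [div_le_div_iff₀ (by norm_num) (by positivity)]; linarith
    have h2 : 1 / r ≤ r * θ ^ 2 := by
      rw [div_le_iff₀ hr0]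
      have : 1 ≤ (r * |θ|) ^ 2 := one_le_pow₀ h1
      rw [mul_pow, sq_abs] at this
      nlinarith
    have h3 : r * Real.cos θ ≤ r + -(1 / (5 * r)) := by
      have h4 : r * Real.cos θ ≤ r * (1 - 2 / Real.pi ^ 2 * θ ^ 2) :=
        mul_le_mul_of_nonneg_left hcos hr0.le
      have h5 : 1 / 5 * (1 / r) ≤ 2 / Real.pi ^ 2 * (r * θ ^ 2) :=
        mul_le_mul h20 h2 (by positivity) (by positivity)
      have h6 : 1 / (5 * r) = 1 / 5 * (1 / r) := by field_simp
      rw [h6]; linarith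
    have h4 : Real.exp (-(1 / (5 * r))) ≤ 1 - 1 / (6 * r) := by
      have h5 := Real.add_one_le_exp (1 / (5 * r))
      rw [Real.exp_neg]
      have h7 : 0 < 1 - 1 / (6 * r) := by
        rw [sub_pos, div_lt_one (by positivity)]; linarith
      rw [inv_le_comm₀ (Real.exp_pos _) h7]
      refine le_trans ?_ h5
      rw [inv_le_iff_one_le_mul₀ h7]
      have h8 : (1 / (5 * r) + 1) * (1 - 1 / (6 * r)) = 1 + (r - 1) / (30 * r ^ 2) := by
        field_simp; ring
      rw [h8]
      have : 0 ≤ (r - 1) / (30 * r ^ 2) := div_nonneg (by linarith) (by positivity)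
      linarith
    have h5 : Real.exp (r * Real.cos θ) * Real.cos (r * Real.sin θ) ≤ E ^ 2 * (1 - 1 / (6 * r)) := by
      refine (mul_le_of_le_one_right (Real.exp_pos _).le (Real.cos_le_one _)).trans ?_
      refine (Real.exp_le_exp.2 h3).trans ?_
      rw [Real.exp_add, hEr]
      exact mul_le_mul_of_nonneg_left h4 (by positivity)
    rw [hEr]
    -- The relative gain `1 / (6 * r)` suffices because `r ^ 2 ≤ E` and `π ≤ 3.15 ≤ 10 / 3`.
    have h6 : r * |θ| * E / 20 ≤ E ^ 2 * (1 / (6 * r)) := by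
      rw [div_le_iff₀ (by norm_num)]
      have h9 : E ^ 2 * (1 / (6 * r)) * 20 = E * (E * (10 / (3 * r))) := by field_simp; ring
      rw [h9]
      have h10 : r * |θ| ≤ E * (10 / (3 * r)) := by
        calc r * |θ| ≤ r * 3.15 := by gcongr; exact hθ.trans hpi
          _ ≤ r ^ 2 * (10 / (3 * r)) := by
            have : r ^ 2 * (10 / (3 * r)) = r * (10 / 3) := by field_simp
            rw [this]; gcongr; norm_num
          _ ≤ E * (10 / (3 * r)) := by gcongr
      nlinarith
    linarith

/-- Perturbing the weight of the blocks changes the main term by a bounded amount. -/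
theorem norm_exp_perturbation_le {r : ℝ} (hr : 1 ≤ r) {τ : ℂ} (hτ : ‖τ‖ ≤ 1 / 8) {θ : ℝ}
    (hθ : |θ| ≤ Real.pi) :
    ‖Complex.exp τ * Complex.exp (r * Complex.exp (θ * Complex.I - τ / r)) -
      Complex.exp (r * Complex.exp (θ * Complex.I))‖ ≤
        Real.exp r * (2 * (‖τ‖ * |θ| + ‖τ‖ ^ 2 / r)) := by
  have hr0 : 0 < r := by linarith
  have hrne : (r : ℂ) ≠ 0 := by exact_mod_cast hr0.ne'
  set u := Complex.exp (θ * Complex.I) with hu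
  have hun : ‖u‖ = 1 := Complex.norm_exp_ofReal_mul_I θ
  -- `ε` is the change of the inner exponent caused by `τ`. Its linear part `τ * (1 - u)` vanishes
  -- at `θ = 0`, which supplies the factor `|θ|` in the bound.
  set ε : ℂ := τ * (1 - u) + r * u * (Complex.exp (-(τ / r)) - 1 - -(τ / r)) with hε
  have hv : ‖-(τ / r)‖ ≤ ‖τ‖ := by
    rw [norm_neg, norm_div, Complex.norm_of_nonneg hr0.le]
    exact div_le_self (norm_nonneg _) hr
  have hεn : ‖ε‖ ≤ ‖τ‖ * |θ| + ‖τ‖ ^ 2 / r := by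
    refine (norm_add_le _ _).trans (add_le_add ?_ ?_)
    · rw [norm_mul, norm_sub_rev]
      exact mul_le_mul_of_nonneg_left (norm_exp_mul_I_sub_one_le θ) (norm_nonneg _)
    · rw [norm_mul, norm_mul, hun, mul_one, Complex.norm_of_nonneg hr0.le]
      refine (mul_le_mul_of_nonneg_left
        (Complex.norm_exp_sub_one_sub_id_le (by linarith)) hr0.le).trans ?_
      rw [norm_neg, norm_div, Complex.norm_of_nonneg hr0.le]
      exact le_of_eq (by field_simp)
  have hε1 : ‖ε‖ ≤ 1 := by
    refine hεn.trans ?_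
    have h1 : ‖τ‖ * |θ| ≤ 1 / 8 * 4 :=
      mul_le_mul hτ (hθ.trans Real.pi_lt_four.le) (abs_nonneg _) (by norm_num)
    have h2 : ‖τ‖ ^ 2 / r ≤ (1 / 8) ^ 2 :=
      (div_le_self (by positivity) hr).trans (pow_le_pow_left₀ (norm_nonneg _) hτ 2)
    linarith
  have hfac : Complex.exp τ * Complex.exp (r * Complex.exp (θ * Complex.I - τ / r)) -
      Complex.exp (r * u) = Complex.exp (r * u) * (Complex.exp ε - 1) := by
    rw [mul_sub, mul_one, ← Complex.exp_add, ← Complex.exp_add, sub_eq_add_neg (θ * Complex.I : ℂ),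
      Complex.exp_add (θ * Complex.I : ℂ), ← hu]
    congr 2
    rw [hε]
    field_simp
    ring
  rw [hfac, norm_mul, Complex.norm_exp]
  refine mul_le_mul (Real.exp_le_exp.2 ?_) ((Complex.norm_exp_sub_one_le hε1).trans ?_)
    (norm_nonneg _) (Real.exp_pos _).le
  · have h := Complex.re_le_norm (r * u)
    rwa [norm_mul, hun, mul_one, Complex.norm_of_nonneg hr0.le] at h
  · linarith

/-- The unperturbed term decays like `-|y| / 20`. The perturbation by `τ` and the Taylor polynomial
cost a constant plus `(2 * M / √r + b r) * |y|`, which for large `r` consumes at most half of that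
decay. The result is the dominating function for the saddle point integral. -/
theorem exists_bound_exp_saddleExponent (s : ℕ) (M : ℝ) : ∃ C : ℝ, ∀ᶠ r in atTop,
    ∀ (t : ℂ) (y : ℝ), ‖t‖ ≤ M → |y * saddleWidth r| ≤ Real.pi →
      ‖Complex.exp (saddleExponent s r (t / blockScale r) (y * saddleWidth r))‖ ≤
        C * Real.exp (-(1 / 40) * |y|) := by
  obtain ⟨b, hb, hbound⟩ := exists_bound_expTaylor s
  -- The three summands come from the decay estimate, the quadratic effect of `τ`, and the Taylor
  -- polynomial.
  refine ⟨Real.exp (1 / 20 + 2 * M ^ 2 + |M|), ?_⟩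
  have hsm : Tendsto (fun r => M / blockScale r) atTop (𝓝 0) :=
    tendsto_blockScale.const_div_atTop M
  have hsq : Tendsto (fun r : ℝ => 2 * (M / √r) + b r) atTop (𝓝 0) := by
    simpa using ((Real.tendsto_sqrt_atTop.const_div_atTop M).const_mul 2).add hb
  have h4 : ∀ᶠ r : ℝ in atTop, r ^ 2 ≤ Real.exp (r / 2) := by
    filter_upwards [(tendsto_pow_mul_exp_neg_half 2).eventually_le_const one_pos] with r hr
    rw [Real.exp_neg, ← div_eq_mul_inv, div_le_one (Real.exp_pos _)] at hr
    exact hr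
  filter_upwards [eventually_ge_atTop 1, hsm.eventually_le_const (by norm_num : (0 : ℝ) < 1 / 8),
    hsq.eventually_le_const (by norm_num : (0 : ℝ) < 1 / 40), hb.eventually_le_const one_pos, h4]
    with r hr h1 h2 h3 h4 t y ht hy
  have hM : 0 ≤ M := (norm_nonneg t).trans ht
  have hr0 : 0 < r := by linarith
  have hτ : ‖t / blockScale r‖ ≤ M / blockScale r := by
    rw [norm_div, Complex.norm_of_nonneg (blockScale_pos hr0).le]
    exact div_le_div_of_nonneg_right ht (blockScale_pos hr0).le
  have hτ8 := hτ.trans h1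
  set τ := t / blockScale r with hτdef
  set θ := y * saddleWidth r with hθdef
  have hE : Real.exp (r / 2) * Real.exp (r / 2) = Real.exp r := by
    rw [← Real.exp_add]; congr 1; ring
  have hE0 := Real.exp_pos (r / 2)
  have hθy : r * |θ| * Real.exp (r / 2) = |y| := by
    rw [hθdef, saddleWidth, abs_mul, abs_of_pos (by positivity : 0 < Real.exp (-(r / 2)) / r),
      Real.exp_neg]
    field_simp
  have hA := exp_sub_exp_mul_cos_ge hr h4 hy
  rw [hθy] at hA
  have hB := (Complex.re_le_norm _).trans (norm_exp_perturbation_le hr hτ8 hy)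
  have hC := (Complex.abs_re_le_norm _).trans (hbound r t y hr (hτ8.trans (by norm_num)))
  rw [← hτdef, ← hθdef] at hC
  have hC' := neg_le_of_abs_le hC
  have hrs : √r * √r = r := Real.mul_self_sqrt hr0.le
  have hs0 : 0 < √r := Real.sqrt_pos.2 hr0
  have hθ' : |θ| = |y| / (r * Real.exp (r / 2)) := by
    rw [← hθy]; field_simp
  have hB1 : Real.exp r * (‖τ‖ * |θ|) ≤ M / √r * |y| := by
    calc Real.exp r * (‖τ‖ * |θ|) ≤ Real.exp r * (M / blockScale r * |θ|) := by gcongr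
      _ = M / √r * |y| := by
        rw [hθ', blockScale, ← hE]
        generalize Real.exp (r / 2) = E at hE0
        have : M / √r * |y| = M * (√r * √r / r) / √r * |y| := by rw [hrs, div_self hr0.ne', mul_one]
        rw [this]
        field_simp
  have hB2 : Real.exp r * (‖τ‖ ^ 2 / r) ≤ M ^ 2 := by
    calc Real.exp r * (‖τ‖ ^ 2 / r) ≤ Real.exp r * ((M / blockScale r) ^ 2 / r) := by gcongr
      _ = M ^ 2 := by
        rw [blockScale, ← hE]
        have : M ^ 2 = M ^ 2 * (√r * √r / r) := by rw [hrs, div_self hr0.ne', mul_one]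
        rw [this]
        generalize Real.exp (r / 2) = E at hE0
        field_simp
  have hre : (Complex.exp (r * Complex.exp (θ * Complex.I))).re =
      Real.exp (r * Real.cos θ) * Real.cos (r * Real.sin θ) := by
    rw [Complex.exp_re]
    simp [Complex.exp_ofReal_mul_I_re, Complex.exp_ofReal_mul_I_im]
  have hsplit : (saddleExponent s r τ θ).re =
      (Complex.exp τ * Complex.exp (r * Complex.exp (θ * Complex.I - τ / r)) -
        Complex.exp (r * Complex.exp (θ * Complex.I))).re +
      (Complex.exp (r * Complex.exp (θ * Complex.I))).re -
      (Complex.exp τ * expTaylor s (r * Complex.exp (θ * Complex.I - τ / r)) -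
        expTaylor s r).re - Real.exp r := by
    have h5 : (r * Complex.exp r * (θ * Complex.I) : ℂ).re = 0 := by
      rw [← Complex.ofReal_exp]; simp
    have h6 : (Complex.exp r).re = Real.exp r := by rw [← Complex.ofReal_exp, Complex.ofReal_re]
    rw [← h6, ← Complex.add_re, ← Complex.sub_re, ← Complex.sub_re,
      ← sub_zero (Complex.re (_ - _)), ← h5, ← Complex.sub_re]
    congr 1
    rw [saddleExponent]
    ring
  rw [Complex.norm_exp, ← Real.exp_add, Real.exp_le_exp, hsplit, hre, abs_of_nonneg hM]
  have hb0 : b r * (‖t‖ + |y|) ≤ M + b r * |y| := by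
    rw [mul_add]
    have : b r * ‖t‖ ≤ 1 * ‖t‖ := mul_le_mul_of_nonneg_right h3 (norm_nonneg _)
    linarith
  have h7 := mul_le_mul_of_nonneg_right h2 (abs_nonneg y)
  nlinarith

/-! ### The saddle point integral: its limit and its relation to partitions. -/

theorem integrable_exp_neg_mul_abs {c : ℝ} (hc : 0 < c) :
    Integrable (fun y : ℝ => Real.exp (-c * |y|)) := by
  rw [← integrableOn_univ, ← Set.Iic_union_Ioi (a := (0 : ℝ))]
  refine IntegrableOn.union ?_ ?_
  · refine (integrableOn_exp_mul_Iic hc 0).congr_fun (fun y hy => ?_) measurableSet_Iic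
    simp only [abs_of_nonpos (Set.mem_Iic.1 hy), neg_mul_neg]
  · refine (integrableOn_exp_mul_Ioi (neg_lt_zero.2 hc) 0).congr_fun (fun y hy => ?_)
      measurableSet_Ioi
    simp only [abs_of_pos (Set.mem_Ioi.1 hy)]

/-- The saddle point integral, normalized by the width of the saddle. -/
noncomputable def saddleIntegral (s : ℕ) (r : ℝ) (τ : ℂ) : ℂ :=
  ((saddleWidth r : ℝ) : ℂ)⁻¹ *
    ∫ θ in (-Real.pi)..Real.pi, Complex.exp (saddleExponent s r τ θ)

theorem saddleIntegral_eq (s : ℕ) {r : ℝ} (hr : 0 < r) (τ : ℂ) :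
    saddleIntegral s r τ = ∫ y : ℝ, Set.indicator
      {y : ℝ | |y * saddleWidth r| ≤ Real.pi}
      (fun y => Complex.exp (saddleExponent s r τ (y * saddleWidth r))) y := by
  have hδ : 0 < saddleWidth r := by unfold saddleWidth; positivity
  have hset : {y : ℝ | |y * saddleWidth r| ≤ Real.pi} =
      Set.Icc (-Real.pi / saddleWidth r) (Real.pi / saddleWidth r) := by
    ext y
    rw [Set.mem_ofPred_eq, abs_le, Set.mem_Icc, div_le_iff₀ hδ, le_div_iff₀ hδ]
  have hle : -Real.pi / saddleWidth r ≤ Real.pi / saddleWidth r := by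
    gcongr; linarith [Real.pi_pos]
  have h := intervalIntegral.integral_comp_mul_right (a := -Real.pi / saddleWidth r)
    (b := Real.pi / saddleWidth r) (fun θ => Complex.exp (saddleExponent s r τ θ)) hδ.ne'
  rw [div_mul_cancel₀ _ hδ.ne', div_mul_cancel₀ _ hδ.ne'] at h
  rw [hset, integral_indicator measurableSet_Icc, integral_Icc_eq_integral_Ioc,
    ← intervalIntegral.integral_of_le hle, h, saddleIntegral, Complex.real_smul, Complex.ofReal_inv]

theorem continuous_saddleExponent (s : ℕ) (r : ℝ) (τ : ℂ) : Continuous (saddleExponent s r τ) := by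
  have := (differentiable_expTaylor s).continuous
  unfold saddleExponent
  fun_prop

/-- Dominated convergence to a Gaussian integral. Letting `t` vary along a general filter yields
both local uniformity in `t` and limits along moving arguments. -/
theorem tendsto_saddleIntegral (s : ℕ) {ι : Type*} {l : Filter ι} [l.IsCountablyGenerated]
    {r : ι → ℝ} {t : ι → ℂ} {c : ℂ} (hr : Tendsto r l atTop) (ht : Tendsto t l (𝓝 c)) :
    Tendsto (fun i => saddleIntegral s (r i) (t i / blockScale (r i))) l
      (𝓝 (Complex.exp (c ^ 2 / 2) * (√(2 * Real.pi) : ℝ))) := by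
  obtain ⟨C, hC⟩ := exists_bound_exp_saddleExponent s (‖c‖ + 1)
  have hC0 : 0 ≤ C := by
    obtain ⟨r, hr⟩ := hC.exists
    have := (norm_nonneg _).trans (hr 0 0 (by simp; positivity) (by simp [Real.pi_pos.le]))
    simpa using this
  have hlim : ∫ y : ℝ, Complex.exp (c ^ 2 / 2 - (y : ℂ) ^ 2 / 2) =
      Complex.exp (c ^ 2 / 2) * (√(2 * Real.pi) : ℝ) := by
    have h1 : ∀ y : ℝ, Complex.exp (c ^ 2 / 2 - (y : ℂ) ^ 2 / 2) =
        Complex.exp (c ^ 2 / 2) * ((Real.exp (-(1 / 2) * y ^ 2) : ℝ) : ℂ) := by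
      intro y
      rw [Complex.ofReal_exp, ← Complex.exp_add]
      congr 1
      push_cast
      ring
    simp_rw [h1]
    rw [integral_const_mul, integral_complex_ofReal, integral_gaussian]
    congr 3
    ring
  rw [← hlim]
  have heq : ∀ᶠ i in l, (∫ y : ℝ, Set.indicator {y : ℝ | |y * saddleWidth (r i)| ≤ Real.pi}
      (fun y => Complex.exp (saddleExponent s (r i) (t i / blockScale (r i))
        (y * saddleWidth (r i)))) y) = saddleIntegral s (r i) (t i / blockScale (r i)) := by
    filter_upwards [hr.eventually_gt_atTop 0] with i hi
    rw [saddleIntegral_eq s hi]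
  refine Tendsto.congr' heq ?_
  refine tendsto_integral_filter_of_dominated_convergence
    (fun y => C * Real.exp (-(1 / 40) * |y|)) ?_ ?_
    ((integrable_exp_neg_mul_abs (by norm_num)).const_mul C) ?_
  · refine Eventually.of_forall fun i => ?_
    refine AEStronglyMeasurable.indicator ?_ ?_
    · have := continuous_saddleExponent s (r i) (t i / blockScale (r i))
      exact Continuous.aestronglyMeasurable (by fun_prop)
    · exact (isClosed_le (by fun_prop) continuous_const).measurableSet
  · have hnorm : ∀ᶠ i in l, ‖t i‖ ≤ ‖c‖ + 1 :=
      ht.norm.eventually_le_const (lt_add_one _)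
    filter_upwards [hr.eventually hC, hnorm] with i hi hti
    refine Eventually.of_forall fun y => ?_
    rw [norm_indicator_eq_indicator_norm]
    refine Set.indicator_apply_le' (fun hy => hi (t i) y hti hy) fun _ => ?_
    positivity
  · refine Eventually.of_forall fun y => ?_
    have h2 := (Complex.continuous_exp.tendsto _).comp (tendsto_saddleExponent s hr ht y)
    refine h2.congr' ?_
    have hw : Tendsto (fun i => |y * saddleWidth (r i)|) l (𝓝 0) := by
      have h3 : Tendsto saddleWidth atTop (𝓝 0) := by
        have h4 := (tendsto_pow_mul_exp_neg_half 0).mul tendsto_inv_atTop_zero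
        rw [zero_mul] at h4
        exact h4.congr fun r => by rw [pow_zero, one_mul, ← div_eq_mul_inv, ← saddleWidth]
      have := ((h3.comp hr).const_mul y).abs
      simpa using this
    filter_upwards [hw.eventually_le_const Real.pi_pos] with i hi
    rw [Set.indicator_of_mem (by exact hi)]
    rfl

/-- What matters is that `K` does not depend on `τ`: it disappears on division by the case `τ = 0`.
-/
theorem exists_sum_exp_eq_mul_saddleIntegral {s : ℕ} (hs : 1 ≤ s) {n : ℕ} {r : ℝ} (hr : 0 < r)
    (hn : r * Real.exp r = n) : ∃ K : ℂ, ∀ τ : ℂ,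
      ∑ P : BigBlockPartition s n, Complex.exp (τ * (numBlocks P - Real.exp r : ℝ)) =
        K * saddleIntegral s r τ := by
  have hrne : (r : ℂ) ≠ 0 := by exact_mod_cast hr.ne'
  have hnC : (r : ℂ) * Complex.exp r = n := by
    rw [← Complex.ofReal_exp]; exact_mod_cast congrArg (fun u : ℝ => (u : ℂ)) hn
  have hδ : ((saddleWidth r : ℝ) : ℂ) ≠ 0 := by
    have : 0 < saddleWidth r := by unfold saddleWidth; positivity
    exact_mod_cast this.ne'
  refine ⟨n.factorial / (2 * Real.pi * (r : ℂ) ^ n) *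
    Complex.exp (Complex.exp r - expTaylor s r) * (saddleWidth r : ℝ), fun τ => ?_⟩
  have h := integral_entire_mul_exp_neg (hasSum_sum_pow_numBlocks hs (Complex.exp τ))
    (r * Complex.exp (-(τ / r))) n
  have hint : ∀ θ : ℝ, Complex.exp (Complex.exp τ *
      (Complex.exp (r * Complex.exp (-(τ / r)) * Complex.exp (θ * Complex.I)) -
        expTaylor s (r * Complex.exp (-(τ / r)) * Complex.exp (θ * Complex.I)))) *
      Complex.exp (-(n * (θ * Complex.I))) =
      Complex.exp (Complex.exp r - expTaylor s r) * Complex.exp (saddleExponent s r τ θ) := by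
    intro θ
    rw [mul_assoc (r : ℂ), ← Complex.exp_add, ← Complex.exp_add, ← Complex.exp_add,
      saddleExponent, hnC, neg_add_eq_sub]
    congr 1
    ring
  -- Since `n / r = exp r`, the power of the radius supplies exactly the centring factor.
  have hpow : (r * Complex.exp (-(τ / r))) ^ n = (r : ℂ) ^ n * Complex.exp (-(τ * Complex.exp r)) := by
    rw [mul_pow, ← Complex.exp_nat_mul, ← hnC]
    congr 2
    field_simp
  simp_rw [hint] at h
  rw [intervalIntegral.integral_const_mul, hpow] at h
  have hsum : ∑ P : BigBlockPartition s n, Complex.exp (τ * (numBlocks P - Real.exp r : ℝ)) =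
      (∑ P : BigBlockPartition s n, Complex.exp τ ^ numBlocks P) *
        Complex.exp (-(τ * Complex.exp r)) := by
    rw [Finset.sum_mul]
    refine Finset.sum_congr rfl fun P _ => ?_
    rw [← Complex.exp_nat_mul, ← Complex.exp_add]
    congr 1
    push_cast
    ring
  have hpi : (Real.pi : ℂ) ≠ 0 := by exact_mod_cast Real.pi_ne_zero
  have hf : (n.factorial : ℂ) ≠ 0 := by exact_mod_cast n.factorial_ne_zero
  rw [hsum, saddleIntegral]
  generalize (∑ P : BigBlockPartition s n, Complex.exp τ ^ numBlocks P) = S at h ⊢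
  generalize (∫ θ in (-Real.pi)..Real.pi, Complex.exp (saddleExponent s r τ θ)) = J at h ⊢
  generalize Complex.exp (-(τ * Complex.exp r)) = e1 at h ⊢
  have hrn : (r : ℂ) ^ n ≠ 0 := pow_ne_zero _ hrne
  calc S * e1 = n.factorial / (2 * Real.pi * (r : ℂ) ^ n) *
        (2 * Real.pi * (S / n.factorial * (r ^ n * e1))) := by field_simp
    _ = _ := by rw [← h]; field_simp

/-! ### The saddle point and its growth. -/

theorem exists_mul_exp_eq (n : ℕ) : ∃ r : ℝ, 0 ≤ r ∧ r * Real.exp r = n := by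
  have hc : ContinuousOn (fun r : ℝ => r * Real.exp r) (Set.Icc 0 n) := by fun_prop
  have hmem : (n : ℝ) ∈ Set.Icc ((0 : ℝ) * Real.exp 0) (n * Real.exp n) := by
    refine ⟨by simp, le_mul_of_one_le_right (by positivity) (Real.one_le_exp (by positivity))⟩
  obtain ⟨r, hr, h⟩ := intermediate_value_Icc (Nat.cast_nonneg n) hc hmem
  exact ⟨r, hr.1, h⟩

/-- The saddle point, that is, the solution `r ≥ 0` of `r * exp r = n`. -/
noncomputable def saddlePoint (n : ℕ) : ℝ := (exists_mul_exp_eq n).choose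

theorem saddlePoint_mul_exp (n : ℕ) : saddlePoint n * Real.exp (saddlePoint n) = n :=
  (exists_mul_exp_eq n).choose_spec.2

theorem tendsto_saddlePoint : Tendsto saddlePoint atTop atTop := by
  rw [tendsto_atTop]
  intro R
  have : ∀ᶠ n : ℕ in atTop, |R| * Real.exp |R| < n :=
    tendsto_natCast_atTop_atTop.eventually_gt_atTop _
  filter_upwards [this] with n hn
  by_contra! h
  have h1 : saddlePoint n ≤ |R| := h.le.trans (le_abs_self R)
  rw [← saddlePoint_mul_exp n] at hn
  have h2 : saddlePoint n * Real.exp (saddlePoint n) ≤ |R| * Real.exp |R| :=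
    mul_le_mul h1 (Real.exp_le_exp.2 h1) (Real.exp_pos _).le (abs_nonneg _)
  linarith

theorem tendsto_log_div_saddlePoint :
    Tendsto (fun n : ℕ => Real.log n / saddlePoint n) atTop (𝓝 1) := by
  have h1 : Tendsto (fun n => Real.log (saddlePoint n) / saddlePoint n + 1) atTop (𝓝 1) := by
    have := (Real.isLittleO_log_id_atTop.tendsto_div_nhds_zero.comp tendsto_saddlePoint).add_const 1
    simpa using this
  refine h1.congr' ?_
  filter_upwards [tendsto_saddlePoint.eventually_gt_atTop 0] with n hn
  have : Real.log n = Real.log (saddlePoint n) + saddlePoint n := by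
    conv_lhs => rw [← saddlePoint_mul_exp n]
    rw [Real.log_mul hn.ne' (Real.exp_pos _).ne', Real.log_exp]
  rw [this, add_div, div_self hn.ne']

/-! ### The limit of the moment generating function. -/

instance BigBlockPartition.instDiscreteMeasurableSpace (s n : ℕ) :
    DiscreteMeasurableSpace (BigBlockPartition s n) := ⟨fun _ => trivial⟩

theorem integral_uniformPartition {E : Type*} [NormedAddCommGroup E] [NormedSpace ℝ E]
    [CompleteSpace E] {s n : ℕ} (h : s ≤ n) (f : BigBlockPartition s n → E) :
    ∫ P, f P ∂(uniformPartition s n) =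
      (Fintype.card (BigBlockPartition s n) : ℝ)⁻¹ • ∑ P, f P := by
  have : IsProbabilityMeasure (uniformPartition s n) :=
    uniformPartition.instIsProbabilityMeasure s ⟨n, h⟩
  rw [integral_fintype (Integrable.of_finite), Finset.smul_sum]
  refine Finset.sum_congr rfl fun P _ => ?_
  congr 1
  rw [uniformPartition, measureReal_def, uniformOn_univ, Measure.count_singleton,
    ENNReal.toReal_div]
  simp

/-- The number of blocks, centred and scaled with the parameters of the saddle. -/
noncomputable def scaledBlocks {s n : ℕ} (P : BigBlockPartition s n) : ℝ :=
  (numBlocks P - Real.exp (saddlePoint n)) / blockScale (saddlePoint n)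

/-- The moment generating function of the scaled number of blocks. -/
noncomputable def blockMgf (s n : ℕ) (t : ℂ) : ℂ :=
  (Fintype.card (BigBlockPartition s n) : ℂ)⁻¹ *
    ∑ P : BigBlockPartition s n, Complex.exp (t * (scaledBlocks P : ℝ))

theorem card_ne_zero_of_le {s n : ℕ} (h : s ≤ n) :
    (Fintype.card (BigBlockPartition s n) : ℂ) ≠ 0 := by
  have := BigBlockPartition.nonempty h
  exact_mod_cast Fintype.card_ne_zero

theorem blockMgf_eq_div {s n : ℕ} (hs : 1 ≤ s) (h : s ≤ n) (hr : 0 < saddlePoint n) (t : ℂ) :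
    blockMgf s n t = saddleIntegral s (saddlePoint n) (t / blockScale (saddlePoint n)) /
      saddleIntegral s (saddlePoint n) 0 := by
  obtain ⟨K, hK⟩ := exists_sum_exp_eq_mul_saddleIntegral hs hr (saddlePoint_mul_exp n)
  have h0 := hK 0
  simp only [zero_mul, Complex.exp_zero, Finset.sum_const, Finset.card_univ, nsmul_eq_mul,
    mul_one] at h0
  have hcard := card_ne_zero_of_le h
  have hK0 : K ≠ 0 := fun hK0 => hcard (by rw [h0, hK0, zero_mul])
  have h1 : ∑ P : BigBlockPartition s n, Complex.exp (t * (scaledBlocks P : ℝ)) =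
      K * saddleIntegral s (saddlePoint n) (t / blockScale (saddlePoint n)) := by
    rw [← hK]
    refine Finset.sum_congr rfl fun P _ => ?_
    congr 1
    rw [scaledBlocks]
    push_cast
    ring
  rw [blockMgf, h1, h0, ← div_eq_inv_mul, mul_div_mul_left _ _ hK0]

theorem tendsto_blockMgf {s : ℕ} (hs : 1 ≤ s) {ι : Type*} {l : Filter ι} [l.IsCountablyGenerated]
    {n : ι → ℕ} {t : ι → ℂ} {c : ℂ} (hn : Tendsto n l atTop) (ht : Tendsto t l (𝓝 c)) :
    Tendsto (fun i => blockMgf s (n i) (t i)) l (𝓝 (Complex.exp (c ^ 2 / 2))) := by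
  have hr := tendsto_saddlePoint.comp hn
  have h1 := tendsto_saddleIntegral s hr ht
  have h2 := tendsto_saddleIntegral s hr (tendsto_const_nhds (x := (0 : ℂ)))
  have hpi : ((√(2 * Real.pi) : ℝ) : ℂ) ≠ 0 := by
    have : 0 < √(2 * Real.pi) := Real.sqrt_pos.2 (by positivity)
    exact_mod_cast this.ne'
  have h3 := h1.div h2 (by simpa using hpi)
  have hlim : Complex.exp (c ^ 2 / 2) * (√(2 * Real.pi) : ℝ) /
      (Complex.exp (0 ^ 2 / 2) * (√(2 * Real.pi) : ℝ)) = Complex.exp (c ^ 2 / 2) := by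
    rw [mul_div_mul_right _ _ hpi]; simp
  rw [hlim] at h3
  refine h3.congr' ?_
  filter_upwards [hn.eventually_ge_atTop s, hr.eventually_gt_atTop 0] with i hi hi'
  rw [blockMgf_eq_div hs hi hi']
  simp [Function.comp]

/-- A joint limit in `(n, t)` with continuous limit function is a locally uniform one. By
Weierstrass's theorem the derivatives, and so the moments, then converge as well. -/
theorem tendstoLocallyUniformlyOn_blockMgf {s : ℕ} (hs : 1 ≤ s) :
    TendstoLocallyUniformlyOn (blockMgf s) (fun t => Complex.exp (t ^ 2 / 2)) atTop Set.univ := by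
  rw [tendstoLocallyUniformlyOn_iff_forall_tendsto]
  intro c _
  rw [nhdsWithin_univ]
  have h1 : Tendsto (fun y : ℕ × ℂ => blockMgf s y.1 y.2) (atTop ×ˢ 𝓝 c)
      (𝓝 (Complex.exp (c ^ 2 / 2))) := tendsto_blockMgf hs tendsto_fst tendsto_snd
  have h2 : Tendsto (fun y : ℕ × ℂ => Complex.exp (y.2 ^ 2 / 2)) (atTop ×ˢ 𝓝 c)
      (𝓝 (Complex.exp (c ^ 2 / 2))) :=
    ((by fun_prop : Continuous fun t : ℂ => Complex.exp (t ^ 2 / 2)).tendsto c).comp tendsto_snd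
  exact (h2.prodMk_nhds h1).mono_right (nhds_le_uniformity _)

/-! ### Moments from derivatives at the origin. -/

theorem hasDerivAt_sum_exp {ι : Type*} [Fintype ι] (a : ℂ) (b y : ι → ℂ) (t : ℂ) :
    HasDerivAt (fun t => a * ∑ i, b i * Complex.exp (t * y i))
      (a * ∑ i, b i * y i * Complex.exp (t * y i)) t := by
  refine (HasDerivAt.fun_sum fun i _ => ?_).const_mul a
  convert! (((hasDerivAt_id t).mul_const (y i)).cexp.const_mul (b i)) using 1
  simp only [id]
  ring

theorem deriv_blockMgf (s n : ℕ) : deriv (blockMgf s n) = fun t =>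
    (Fintype.card (BigBlockPartition s n) : ℂ)⁻¹ * ∑ P : BigBlockPartition s n,
      (scaledBlocks P : ℂ) * Complex.exp (t * (scaledBlocks P : ℝ)) := by
  ext t
  have h := (hasDerivAt_sum_exp (Fintype.card (BigBlockPartition s n) : ℂ)⁻¹ (fun _ => 1)
    (fun P : BigBlockPartition s n => (scaledBlocks P : ℂ)) t).deriv
  simp only [one_mul] at h
  exact h

theorem deriv_deriv_blockMgf (s n : ℕ) : deriv (deriv (blockMgf s n)) = fun t =>
    (Fintype.card (BigBlockPartition s n) : ℂ)⁻¹ * ∑ P : BigBlockPartition s n,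
      (scaledBlocks P : ℂ) * scaledBlocks P * Complex.exp (t * (scaledBlocks P : ℝ)) := by
  rw [deriv_blockMgf]
  ext t
  exact (hasDerivAt_sum_exp _ (fun P : BigBlockPartition s n => (scaledBlocks P : ℂ)) _ t).deriv

theorem differentiable_blockMgf (s n : ℕ) : Differentiable ℂ (blockMgf s n) := by
  unfold blockMgf; fun_prop

/-- The mean of the scaled number of blocks tends to `0`. -/
theorem tendsto_mean_scaledBlocks {s : ℕ} (hs : 1 ≤ s) :
    Tendsto (fun n => (Fintype.card (BigBlockPartition s n) : ℝ)⁻¹ *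
      ∑ P : BigBlockPartition s n, scaledBlocks P) atTop (𝓝 0) := by
  have h := (tendstoLocallyUniformlyOn_blockMgf hs).deriv
    (Eventually.of_forall fun n => (differentiable_blockMgf s n).differentiableOn) isOpen_univ
  have h0 := h.tendsto_at (Set.mem_univ 0)
  have hd : ∀ t : ℂ, HasDerivAt (fun t : ℂ => Complex.exp (t ^ 2 / 2))
      (Complex.exp (t ^ 2 / 2) * t) t := by
    intro t
    convert! (((hasDerivAt_pow 2 t).div_const 2).cexp) using 2
    simp
  rw [(hd 0).deriv, mul_zero] at h0
  have h1 := (Complex.continuous_re.tendsto _).comp h0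
  rw [Complex.zero_re] at h1
  refine h1.congr fun n => ?_
  simp only [Function.comp, deriv_blockMgf, zero_mul, Complex.exp_zero, mul_one]
  rw [← Complex.ofReal_re ((Fintype.card (BigBlockPartition s n) : ℝ)⁻¹ * _)]
  push_cast
  rfl

/-- The second moment of the scaled number of blocks tends to `1`. -/
theorem tendsto_secondMoment_scaledBlocks {s : ℕ} (hs : 1 ≤ s) :
    Tendsto (fun n => (Fintype.card (BigBlockPartition s n) : ℝ)⁻¹ *
      ∑ P : BigBlockPartition s n, scaledBlocks P ^ 2) atTop (𝓝 1) := by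
  have h := (tendstoLocallyUniformlyOn_blockMgf hs).deriv
    (Eventually.of_forall fun n => (differentiable_blockMgf s n).differentiableOn) isOpen_univ
  have h2 := h.deriv (Eventually.of_forall fun n =>
    ((differentiable_blockMgf s n).contDiff (n := 2)).differentiable_deriv_two.differentiableOn)
    isOpen_univ
  have h0 := h2.tendsto_at (Set.mem_univ 0)
  have hd : deriv (fun t : ℂ => Complex.exp (t ^ 2 / 2)) = fun t => Complex.exp (t ^ 2 / 2) * t := by
    ext t
    have : HasDerivAt (fun t : ℂ => Complex.exp (t ^ 2 / 2)) (Complex.exp (t ^ 2 / 2) * t) t := by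
      convert! (((hasDerivAt_pow 2 t).div_const 2).cexp) using 2
      simp
    exact this.deriv
  have hdd : deriv (fun t : ℂ => Complex.exp (t ^ 2 / 2) * t) 0 = 1 := by
    have h3 : DifferentiableAt ℂ (fun t : ℂ => Complex.exp (t ^ 2 / 2)) 0 := by fun_prop
    have := (h3.hasDerivAt.fun_mul (hasDerivAt_id' (0 : ℂ))).deriv
    simpa using this
  rw [hd, hdd] at h0
  have h1 := (Complex.continuous_re.tendsto _).comp h0
  rw [Complex.one_re] at h1
  refine h1.congr fun n => ?_
  simp only [Function.comp, deriv_deriv_blockMgf, zero_mul, Complex.exp_zero, mul_one]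
  rw [← Complex.ofReal_re ((Fintype.card (BigBlockPartition s n) : ℝ)⁻¹ * _)]
  push_cast
  simp only [sq]

/-! ### Asymptotics of the mean and the variance. -/

theorem numBlocks_eq {s n : ℕ} (hr : 0 < saddlePoint n) (P : BigBlockPartition s n) :
    (numBlocks P : ℝ) =
      Real.exp (saddlePoint n) + blockScale (saddlePoint n) * scaledBlocks P := by
  rw [scaledBlocks, mul_div_cancel₀ _ (blockScale_pos hr).ne']
  ring

theorem mean_scaledBlocks {s n : ℕ} (h : s ≤ n) (hr : 0 < saddlePoint n) :
    meanBlocks s n = Real.exp (saddlePoint n) + blockScale (saddlePoint n) *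
      ((Fintype.card (BigBlockPartition s n) : ℝ)⁻¹ *
        ∑ P : BigBlockPartition s n, scaledBlocks P) := by
  have hcard : (Fintype.card (BigBlockPartition s n) : ℝ) ≠ 0 := by
    exact_mod_cast card_ne_zero_of_le h
  rw [meanBlocks, integral_uniformPartition h]
  simp_rw [numBlocks_eq hr]
  rw [Finset.sum_add_distrib, ← Finset.mul_sum, Finset.sum_const, Finset.card_univ, nsmul_eq_mul,
    smul_eq_mul]
  field_simp

theorem var_scaledBlocks {s n : ℕ} (h : s ≤ n) (hr : 0 < saddlePoint n) :
    varBlocks s n = blockScale (saddlePoint n) ^ 2 *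
      ((Fintype.card (BigBlockPartition s n) : ℝ)⁻¹ *
        ∑ P : BigBlockPartition s n, scaledBlocks P ^ 2 -
      ((Fintype.card (BigBlockPartition s n) : ℝ)⁻¹ *
        ∑ P : BigBlockPartition s n, scaledBlocks P) ^ 2) := by
  have : IsProbabilityMeasure (uniformPartition s n) :=
    uniformPartition.instIsProbabilityMeasure s ⟨n, h⟩
  have h1 : (fun P : BigBlockPartition s n => (numBlocks P : ℝ)) = fun P =>
      Real.exp (saddlePoint n) + blockScale (saddlePoint n) * scaledBlocks P :=
    funext (numBlocks_eq hr)
  rw [varBlocks, h1, variance_const_add (Measurable.of_discrete.aestronglyMeasurable),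
    variance_const_mul, variance_eq_sub (MemLp.of_discrete), integral_uniformPartition h,
    integral_uniformPartition h]
  rfl

theorem blockScale_sq {r : ℝ} (hr : 0 < r) : blockScale r ^ 2 = Real.exp r / r := by
  rw [blockScale, div_pow, Real.sq_sqrt hr.le, ← Real.exp_nat_mul]
  congr 2
  push_cast
  ring

theorem meanBlocks_isEquivalent {s : ℕ} (hs : 1 ≤ s) :
    (fun n : ℕ => meanBlocks s n) ~[atTop] (fun n : ℕ => (n : ℝ) / Real.log n) := by
  have hne : ∀ᶠ n : ℕ in atTop, (n : ℝ) / Real.log n ≠ 0 := by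
    filter_upwards [eventually_ge_atTop 2] with n hn
    have : (1 : ℝ) < n := by exact_mod_cast hn
    exact div_ne_zero (by linarith) (Real.log_pos this).ne'
  rw [isEquivalent_iff_tendsto_one hne]
  have hr := tendsto_saddlePoint
  -- This is `blockScale r / exp r`: the standard deviation is negligible against the mean.
  have hsmall : Tendsto (fun n => (√(saddlePoint n) * Real.exp (saddlePoint n / 2))⁻¹)
      atTop (𝓝 0) :=
    ((Real.tendsto_sqrt_atTop.comp hr).atTop_mul_atTop₀
      (Real.tendsto_exp_atTop.comp (hr.atTop_div_const two_pos))).inv_tendsto_atTop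
  have h1 := tendsto_log_div_saddlePoint.mul
    ((hsmall.mul (tendsto_mean_scaledBlocks hs)).const_add 1)
  rw [mul_zero, add_zero, mul_one] at h1
  refine h1.congr' ?_
  filter_upwards [eventually_ge_atTop s, hr.eventually_gt_atTop 0] with n hn hn0
  rw [Pi.div_apply, mean_scaledBlocks hn hn0]
  generalize (Fintype.card (BigBlockPartition s n) : ℝ)⁻¹ *
    ∑ P : BigBlockPartition s n, scaledBlocks P = m
  have he : Real.exp (saddlePoint n) =
      Real.exp (saddlePoint n / 2) * Real.exp (saddlePoint n / 2) := by
    rw [← Real.exp_add]; congr 1; ring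
  have hnr : (n : ℝ) = saddlePoint n *
      (Real.exp (saddlePoint n / 2) * Real.exp (saddlePoint n / 2)) := by
    rw [← he]; exact (saddlePoint_mul_exp n).symm
  generalize Real.log n = L
  rw [hnr, he, blockScale]
  have hE := Real.exp_pos (saddlePoint n / 2)
  generalize Real.exp (saddlePoint n / 2) = E at hE
  have hq := Real.sqrt_pos.2 hn0
  field_simp

theorem tendsto_var_div_blockScale_sq {s : ℕ} (hs : 1 ≤ s) :
    Tendsto (fun n => varBlocks s n / blockScale (saddlePoint n) ^ 2) atTop (𝓝 1) := by
  have h1 := (tendsto_secondMoment_scaledBlocks hs).sub ((tendsto_mean_scaledBlocks hs).pow 2)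
  rw [zero_pow two_ne_zero, sub_zero] at h1
  refine h1.congr' ?_
  filter_upwards [eventually_ge_atTop s, tendsto_saddlePoint.eventually_gt_atTop 0] with n hn hn0
  rw [var_scaledBlocks hn hn0, mul_div_cancel_left₀ _ (pow_ne_zero 2 (blockScale_pos hn0).ne')]

theorem varBlocks_isEquivalent {s : ℕ} (hs : 1 ≤ s) :
    (fun n : ℕ => varBlocks s n) ~[atTop] (fun n : ℕ => (n : ℝ) / Real.log n ^ 2) := by
  have hne : ∀ᶠ n : ℕ in atTop, (n : ℝ) / Real.log n ^ 2 ≠ 0 := by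
    filter_upwards [eventually_ge_atTop 2] with n hn
    have : (1 : ℝ) < n := by exact_mod_cast hn
    exact div_ne_zero (by linarith) (pow_ne_zero 2 (Real.log_pos this).ne')
  rw [isEquivalent_iff_tendsto_one hne]
  have h1 := (tendsto_var_div_blockScale_sq hs).mul (tendsto_log_div_saddlePoint.pow 2)
  rw [one_pow, mul_one] at h1
  refine h1.congr' ?_
  filter_upwards [tendsto_saddlePoint.eventually_gt_atTop 0] with n hn0
  have hnr := saddlePoint_mul_exp n
  rw [Pi.div_apply, blockScale_sq hn0]
  generalize Real.log n = L
  rw [← hnr]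
  have hE := Real.exp_pos (saddlePoint n)
  field_simp

/-! ### Convergence in distribution. -/

theorem tendsto_charFun_standardized {s : ℕ} (hs : 1 ≤ s) (u : ℝ) :
    Tendsto (fun n => (Fintype.card (BigBlockPartition s n) : ℂ)⁻¹ *
      ∑ P : BigBlockPartition s n, Complex.exp
        (u * ((((numBlocks P : ℝ) - meanBlocks s n) / √(varBlocks s n) : ℝ) : ℂ) * Complex.I))
      atTop (𝓝 (Complex.exp (-u ^ 2 / 2))) := by
  set V : ℕ → ℝ := fun n => √(varBlocks s n / blockScale (saddlePoint n) ^ 2) with hV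
  set m : ℕ → ℝ := fun n => (Fintype.card (BigBlockPartition s n) : ℝ)⁻¹ *
    ∑ P : BigBlockPartition s n, scaledBlocks P with hm
  have hV1 : Tendsto (fun n => ((u / V n : ℝ) : ℂ)) atTop (𝓝 u) := by
    have := (tendsto_var_div_blockScale_sq hs).sqrt
    rw [Real.sqrt_one] at this
    have h2 := (tendsto_const_nhds (x := u)).div this one_ne_zero
    rw [div_one] at h2
    exact (Complex.continuous_ofReal.tendsto u).comp h2
  have hm0 : Tendsto (fun n => ((m n : ℝ) : ℂ)) atTop (𝓝 0) := by
    have := (Complex.continuous_ofReal.tendsto 0).comp (tendsto_mean_scaledBlocks hs)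
    rwa [Complex.ofReal_zero] at this
  -- The moving argument `u / V n * I` absorbs the passage from `blockScale` to the true standard
  -- deviation, so no Slutsky argument is needed.
  have h1 := tendsto_blockMgf hs tendsto_id (hV1.mul_const Complex.I)
  have h2 := (Complex.continuous_exp.tendsto _).comp ((hV1.mul_const Complex.I).mul hm0).neg
  have h3 := h2.mul h1
  have hlim : Complex.exp (-(u * Complex.I * 0)) * Complex.exp ((u * Complex.I) ^ 2 / 2) =
      Complex.exp (-u ^ 2 / 2) := by
    rw [← Complex.exp_add, mul_pow, Complex.I_sq]
    congr 1
    ring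
  rw [hlim] at h3
  refine h3.congr' ?_
  filter_upwards [eventually_ge_atTop s, tendsto_saddlePoint.eventually_gt_atTop 0] with n hn hn0
  have hσ := blockScale_pos hn0
  have hsqrt : √(varBlocks s n) = blockScale (saddlePoint n) * V n := by
    simp only [hV]
    rw [Real.sqrt_div' _ (by positivity), Real.sqrt_sq hσ.le, mul_div_cancel₀ _ hσ.ne']
  rw [Function.comp, id, blockMgf, mul_left_comm, Finset.mul_sum]
  congr 1
  refine Finset.sum_congr rfl fun P _ => ?_
  have hmean : meanBlocks s n =
      Real.exp (saddlePoint n) + blockScale (saddlePoint n) * m n := mean_scaledBlocks hn hn0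
  rw [← Complex.exp_add, hmean, hsqrt, numBlocks_eq hn0,
    add_sub_add_left_eq_sub, ← mul_sub, mul_div_mul_left _ _ hσ.ne']
  congr 1
  push_cast
  ring

theorem tendsto_subtype_val_atTop (s : ℕ) :
    Tendsto (fun n : {n : ℕ // s ≤ n} => (n : ℕ)) atTop atTop := by
  rw [tendsto_atTop]
  intro N
  filter_upwards [eventually_ge_atTop (⟨max s N, le_max_left _ _⟩ : {n : ℕ // s ≤ n})] with n hn
  exact (le_max_right s N).trans hn

theorem tendstoInDistribution_numBlocks {s : ℕ} (hs : 1 ≤ s) :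
    TendstoInDistribution
      (fun (n : {n : ℕ // s ≤ n}) (P : BigBlockPartition s n) =>
        ((numBlocks P : ℝ) - meanBlocks s n) / √(varBlocks s n))
      atTop (id : ℝ → ℝ) (fun n => uniformPartition s n) (gaussianReal 0 1) where
  forall_aemeasurable _ := Measurable.of_discrete.aemeasurable
  aemeasurable_limit := aemeasurable_id
  tendsto := by
    refine tendsto_of_seq_tendsto fun v hv => ?_
    -- Lévy's continuity theorem, applied along an arbitrary sequence of indices `n ≥ s` tending to
    -- infinity.
    refine ProbabilityMeasure.tendsto_iff_tendsto_charFun.2 fun u => ?_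
    have h := (tendsto_charFun_standardized hs u).comp ((tendsto_subtype_val_atTop s).comp hv)
    have hlim : Complex.exp (u * (0 : ℝ) * Complex.I - ((1 : NNReal) : ℝ) * u ^ 2 / 2) =
        Complex.exp (-u ^ 2 / 2) := by
      congr 1; simp; ring
    rw [ProbabilityMeasure.coe_mk, Measure.map_id, charFun_gaussianReal, hlim]
    refine h.congr fun k => ?_
    change _ = charFun (Measure.map (fun P : BigBlockPartition s (v k) =>
      ((numBlocks P : ℝ) - meanBlocks s (v k)) / √(varBlocks s (v k)))
      (uniformPartition s (v k))) u
    rw [charFun_apply_real, integral_map Measurable.of_discrete.aemeasurable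
      (Continuous.aestronglyMeasurable (by fun_prop)), integral_uniformPartition (v k).2,
      Complex.real_smul]
    push_cast
    rfl

theorem mainTheorem3 (s : ℕ) (hs : 1 ≤ s) :
    -- the number of blocks, standardized by its mean and its standard deviation,
    -- converges in distribution to the standard normal law
    TendstoInDistribution
        (fun (n : {n : ℕ // s ≤ n}) (P : BigBlockPartition s n) =>
          ((numBlocks P : ℝ) - meanBlocks s n) / √(varBlocks s n))
        atTop (id : ℝ → ℝ)
        (fun n => uniformPartition s n) (gaussianReal 0 1) ∧
      -- asymptotics of the mean and of the variance
      (fun n : ℕ => meanBlocks s n) ~[atTop] (fun n : ℕ => (n : ℝ) / Real.log n) ∧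
      (fun n : ℕ => varBlocks s n) ~[atTop] (fun n : ℕ => (n : ℝ) / Real.log n ^ 2) ∧
      -- the bivariate generating function
      (∀ x z : ℂ,
        HasSum
          (fun n : ℕ =>
            z ^ n / (n.factorial : ℂ) *
              ∑ k ∈ Finset.range (n + 1), (assocStirling s n k : ℂ) * x ^ k)
          (Complex.exp
            (x * (Complex.exp z - ∑ j ∈ Finset.range s, z ^ j / (j.factorial : ℂ))))) := by
  refine ⟨tendstoInDistribution_numBlocks hs, meanBlocks_isEquivalent hs,
    varBlocks_isEquivalent hs, fun x z => ?_⟩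
  have h := hasSum_sum_pow_numBlocks hs x z
  rw [expTaylor] at h
  convert! h using 2 with n
  rw [sum_assocStirling_mul_pow]
  ring
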